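/- **Setting.** Consider the linear system $x_{t+1}=Ax_t+Bu_t+w_t$, $y_t=Cx_t+e_t$ with $u_t\in\mathbb R^{d_u}$, $y_t\in\mathbb R^{d_y}$, a fixed initial state $x_1$ and arbitrary (adversarial) sequences $w_t,e_t$. Let $\|\cdot\|_{\mathrm{op}}$ be the Euclidean operator norm, and let $K\in\mathbb R^{d_u\times d_y}$ be a known feedback matrix. Let $v^K_t=(y^K_t,u^K_t)$ be the trajectory under $u_t=Ky_t$, and let $G_K$ be the Markov operator $$G_K^{[0]}=\begin{bmatrix}0\\ I\end{bmatrix},\qquad G_K^{[i]}=\begin{bmatrix}C\\ KC\end{bmatrix}(A+BKC)^{i-1}B\quad(i\ge 1).$$ **Assumptions.** * Each loss $\ell_t:\mathbb R^{d_y+d_u}\to\mathbb R$ is differentiable and $\alpha$-strongly convex ($\alpha>0$), with $0\le \ell_t(v)\le L\max\{1,\|v\|^2\}$ and $\|\nabla\ell_t(v)\|\le L\max\{1,\|v\|\}$ for all $v$. * $\|v^K_t\|\le R_{\mathrm{nat}}$ for all $t\ge1$, where $R_{\mathrm{nat}}\ge 1$. * $\|G_K^{[n]}\|_{\mathrm{op}}\le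 c_K\rho_K^n$ for all $n\ge0$, where $c_K>0$ and $\rho_K\in(0,1)$. **Benchmark.** A linear dynamic controller $\pi=(A_\pi,B_\pi,C_\pi,D_\pi)$ with internal state of any finite dimension is $s_{t+1}=A_\pi s_t+B_\pi y_t$, $u_t=C_\pi s_t+D_\pi y_t$, $s_1=0$; let $(y^\pi_t,u^\pi_t)$ be its closed-loop trajectory. Put $G_{\pi,\mathrm{cl}}^{[0]}=[D_\pi\ \ 0]$ and, for $i\ge1$, $$G_{\pi,\mathrm{cl}}^{[i]}=\begin{bmatrix}(D_\pi-K)C & C_\pi\end{bmatrix}\begin{bmatrix}A+BD_\pi C& BC_\pi\\ B_\pi C&A_\pi\end{bmatrix}^{i-1}\begin{bmatrix}BD_\pi&-B\\ B_\pi&0\end{bmatrix}.$$ For $c_\star\ge 1$ and $\rho_\star\in(0,1)$ let $\Pi_{\mathrm{stab}}(c_\star,\rho_\star)=\{\pi:\ \|G_{\pi,\mathrm{cl}}^{[n]}\|_{\mathrm{op}}\le c_\star\rho_\star^n\ \ \forall n\ge0\}$. The control regret of an algorithm with trajectory $(y^{\mathsf{alg}}_t,u^{\mathsf{alg}}_t)$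 against a class $\Pi$ is $$\mathrm{ControlReg}_T(\mathsf{alg};\Pi)=\sum_{t=1}^T\ell_t(y^{\mathsf{alg}}_t,u^{\mathsf{alg}}_t)-\inf_{\pi\in\Pi}\sum_{t=1}^T\ell_t(y^\pi_t,u^\pi_t).$$ **Algorithm (DRC-ONS, known system).** It has parameters $h,m\in\mathbb N$ and $R_{\mathcal M},\eta,\lambda$. Its parameter set $\mathcal M$ consists of all $M=(M^{[0]},\dots,M^{[m-1]})$, $M^{[i]}\in\mathbb R^{d_u\times d_y}$, with $\sum_{i<m}\|M^{[i]}\|_{\mathrm{op}}\le R_{\mathcal M}$, identified with a subset of $\mathbb R^{m d_u d_y}$ by listing entries, $M\leftrightarrow z$. Start from any $z_1\in\mathcal M$ and $\Lambda_0=\lambda I$. In round $t$: 1. observe $y_t$ and compute $y^{\mathrm{nat}}_t=y_t-\sum_{i<t}G_{K,y}^{[t-i]}u^{\mathrm{ex}}_i$, where $G_{K,y}$ denotes the first $d_y$ rows of $G_K$; 2. play $u_t=Ky_t+u^{\mathrm{ex}}_t$ with $u^{\mathrm{ex}}_t=\sum_{i<m}M_t^{[i]}y^{\mathrm{nat}}_{t-i}$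 (terms with index before round $1$ are $0$); 3. receive $\ell_t$. Let $Y_s$ be the matrix of $M\mapsto\sum_{i<m}M^{[i]}y^{\mathrm{nat}}_{s-i}$ (with $Y_s=0$ for $s\le0$), let $H_t=\sum_{i=0}^hG_K^{[i]}Y_{t-i}$, and let $f_t(z)=\ell_t\big((y^{\mathrm{nat}}_t,Ky^{\mathrm{nat}}_t)+H_tz\big)$; 4. set $\Lambda_t=\Lambda_{t-1}+H_t^\top H_t$, $\tilde z_{t+1}=z_t-\eta\Lambda_t^{-1}\nabla f_t(z_t)$ and $z_{t+1}\in\arg\min_{z\in\mathcal M}\|\Lambda_t^{1/2}(z-\tilde z_{t+1})\|$. **Theorem.** There is a universal constant $\mathfrak C>0$ such that, in this setting and for every horizon $T$, DRC-ONS run with $$h=\Big\lceil\tfrac{\log T}{1-\rho_K}\Big\rceil,\quad m=\Big\lceil\tfrac{\log T}{1-\rho_\star}\Big\rceil,\quad R_{\mathcal M}=(1+\|K\|_{\mathrm{op}})\tfrac{c_\star}{1-\rho_\star},\quad \eta=\tfrac1\alpha,\quad \lambda=6hR_{\mathrm{nat}}^2\tfrac{c_K^2}{(1-\rho_K)^2}$$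 satisfies $$\mathrm{ControlReg}_T(\mathsf{alg};\Pi_{\mathrm{stab}}(c_\star,\rho_\star))\le \mathfrak C\cdot\frac{c_K^3c_\star^2(1+\|K\|_{\mathrm{op}})^3}{(1-\rho_K)^5(1-\rho_\star)^3}\cdot d_ud_yR_{\mathrm{nat}}^2\cdot\frac{L^2}{\alpha}\log^4(1+T).$$ -/

import Mathlib

open Matrix

noncomputable section

namespace DrcOns

/-! Time is indexed by `t = 0, 1, 2, …`; index `t` stands for round `t + 1` when
rounds are counted from `1`, and the `T` rounds are the elements of `Finset.range T`. -/

/-- Vectors of states, outputs and inputs (no norm on this type is used). -/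
abbrev Vec (n : ℕ) : Type := Fin n → ℝ

/-- The space `ℝ^{d_y + d_u}` of pairs `v = (y, u)`, with its Euclidean norm. -/
abbrev Sig (dy du : ℕ) : Type := EuclideanSpace ℝ (Fin dy ⊕ Fin du)

/-- The pair `v = (y, u)`. -/
def pair {dy du : ℕ} (y : Vec dy) (u : Vec du) : Sig dy du :=
  WithLp.toLp 2 (Sum.elim y u)

/-- Euclidean operator norm (largest singular value) of a rectangular matrix. -/
def opNorm {p q : Type*} [Fintype p] [Fintype q] [DecidableEq q] (M : Matrix p q ℝ) : ℝ :=
  ‖LinearMap.toContinuousLinearMap (Matrix.toEuclideanLin M)‖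

/-- A partially observed linear system
`x_{t+1} = A x_t + B u_t + w_t`, `y_t = C x_t + e_t`, with its initial state and its
(adversarial) disturbance sequences. -/
structure Plant (dx du dy : ℕ) where
  A : Matrix (Fin dx) (Fin dx) ℝ
  B : Matrix (Fin dx) (Fin du) ℝ
  C : Matrix (Fin dy) (Fin dx) ℝ
  x₁ : Vec dx
  w : ℕ → Vec dx
  e : ℕ → Vec dy

/-- A linear dynamic controller `s_{t+1} = A s_t + B y_t`, `u_t = C s_t + D y_t`, with an
internal state of arbitrary finite dimension. -/
structure LDC (du dy : ℕ) where
  dim : ℕ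
  A : Matrix (Fin dim) (Fin dim) ℝ
  B : Matrix (Fin dim) (Fin dy) ℝ
  C : Matrix (Fin du) (Fin dim) ℝ
  D : Matrix (Fin du) (Fin dy) ℝ

/-- The static feedback law `u_t = K y_t` as a linear dynamic controller. -/
def LDC.static {du dy : ℕ} (K : Matrix (Fin du) (Fin dy) ℝ) : LDC du dy where
  dim := 0
  A := 0
  B := 0
  C := 0
  D := K

variable {dx du dy : ℕ}

/-- Closed-loop states `(x_t^π, s_t^π)`; the controller's internal state starts at `0`. -/
def ldcState (P : Plant dx du dy) (π : LDC du dy) : ℕ → Vec dx × Vec π.dim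
  | 0 => (P.x₁, 0)
  | t + 1 =>
    let x := (ldcState P π t).1
    let s := (ldcState P π t).2
    let y := P.C *ᵥ x + P.e t
    let u := π.C *ᵥ s + π.D *ᵥ y
    (P.A *ᵥ x + P.B *ᵥ u + P.w t, π.A *ᵥ s + π.B *ᵥ y)

/-- Closed-loop iterates `(y_t^π, u_t^π)`. -/
def ldcIterate (P : Plant dx du dy) (π : LDC du dy) (t : ℕ) : Sig dy du :=
  let x := (ldcState P π t).1
  let s := (ldcState P π t).2
  let y := P.C *ᵥ x + P.e t
  pair y (π.C *ᵥ s + π.D *ᵥ y)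

/-- Nature's iterates `v_t^K = (y_t^K, u_t^K)`: the trajectory under `u_t = K y_t`. -/
def natIterate (P : Plant dx du dy) (K : Matrix (Fin du) (Fin dy) ℝ) (t : ℕ) : Sig dy du :=
  ldcIterate P (LDC.static K) t

/-- The nominal Markov operator `G_K`, from exogenous inputs `u^ex` (where `u = K y + u^ex`) to
`(y, u)`: `G_K^{[0]} = [0; I]` and `G_K^{[i]} = [C; K C] (A + B K C)^{i-1} B` for `i ≥ 1`. -/
def markovK (P : Plant dx du dy) (K : Matrix (Fin du) (Fin dy) ℝ) :
    ℕ → Matrix (Fin dy ⊕ Fin du) (Fin du) ℝ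
  | 0 => Matrix.fromRows 0 1
  | i + 1 => Matrix.fromRows P.C (K * P.C) * (P.A + P.B * K * P.C) ^ i * P.B

/-- The closed-loop Markov operator `G_{π,cl}` of a linear dynamic controller `π`, relative to
the static stabilizing feedback `K`. -/
def markovCl (P : Plant dx du dy) (K : Matrix (Fin du) (Fin dy) ℝ) (π : LDC du dy) :
    ℕ → Matrix (Fin du) (Fin dy ⊕ Fin du) ℝ
  | 0 => Matrix.fromCols π.D 0
  | i + 1 =>
    Matrix.fromCols ((π.D - K) * P.C) π.C *
      Matrix.fromBlocks (P.A + P.B * π.D * P.C) (P.B * π.C) (π.B * P.C) π.A ^ i *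
      Matrix.fromBlocks (P.B * π.D) (-P.B) π.B 0

/-- The comparator class `Π_stab(c, ρ)`. -/
def stabClass (P : Plant dx du dy) (K : Matrix (Fin du) (Fin dy) ℝ) (c ρ : ℝ) :
    Set (LDC du dy) :=
  {π | ∀ n : ℕ, opNorm (markovCl P K π n) ≤ c * ρ ^ n}

/-- Regular losses: differentiable, `α`-strongly convex and `L`-subquadratic. -/
structure LossRegular (L α : ℝ) (ℓ : Sig dy du → ℝ) : Prop where
  differentiable : Differentiable ℝ ℓ
  strongConvex : StrongConvexOn Set.univ α ℓ
  nonneg : ∀ v, 0 ≤ ℓ v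
  le : ∀ v, ℓ v ≤ L * max 1 (‖v‖ ^ 2)
  gradient_le : ∀ v, ‖gradient ℓ v‖ ≤ L * max 1 ‖v‖

/-! ### The algorithm -/

/-- Disturbance-response parameters `M = (M^{[0]}, …, M^{[m-1]})`, flattened to a Euclidean
vector `z` with coordinates `z (i, a, b) = M^{[i]}_{a b}`. -/
abbrev Param (m du dy : ℕ) : Type := EuclideanSpace ℝ (Fin m × Fin du × Fin dy)

/-- The matrix `M^{[i]}` encoded by `z`. -/
def Param.mat {m : ℕ} (z : Param m du dy) (i : Fin m) : Matrix (Fin du) (Fin dy) ℝ :=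
  Matrix.of fun a b => z (i, a, b)

/-- The constraint set `∑_{i < m} ‖M^{[i]}‖_op ≤ R`. -/
def drcSet (m du dy : ℕ) (R : ℝ) : Set (Param m du dy) :=
  {z | ∑ i : Fin m, opNorm (z.mat i) ≤ R}

/-- The matrix `Y_t` of the linear map `z ↦ ∑_{i < m} M^{[i]} ω_{t-i}`
(with `ω_s = 0` before the first round). -/
def embedY (m du : ℕ) (ω : ℕ → Vec dy) (t : ℕ) :
    Matrix (Fin du) (Fin m × Fin du × Fin dy) ℝ :=
  Matrix.of fun a j => if a = j.2.1 ∧ (j.1 : ℕ) ≤ t then ω (t - j.1) j.2.2 else 0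

/-- `H_t = ∑_{i=0}^h G^{[i]} Y_{t-i}` (with `Y_s = 0` before the first round). -/
def featH (h m : ℕ) (G : ℕ → Matrix (Fin dy ⊕ Fin du) (Fin du) ℝ) (ω : ℕ → Vec dy) (t : ℕ) :
    Matrix (Fin dy ⊕ Fin du) (Fin m × Fin du × Fin dy) ℝ :=
  ∑ i ∈ Finset.range (h + 1), if i ≤ t then G i * embedY m du ω (t - i) else 0

open Classical in
/-- A minimizer over `S` of `‖Λ^{1/2} (z - p)‖² = (z - p)ᵀ Λ (z - p)`. -/
def weightedProj {ι : Type*} [Fintype ι] (S : Set (EuclideanSpace ℝ ι)) (Λ : Matrix ι ι ℝ)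
    (p : EuclideanSpace ℝ ι) : EuclideanSpace ℝ ι :=
  if hz : ∃ z ∈ S, IsMinOn (fun q : EuclideanSpace ℝ ι => (q - p).ofLp ⬝ᵥ (Λ *ᵥ (q - p).ofLp)) S z
  then hz.choose else p

/-- One projected semi-Newton step: `z ↦ argmin_{q ∈ S} ‖Λ^{1/2} (q - (z - η Λ⁻¹ ∇f(z)))‖`. -/
def semiOnsStep {ι : Type*} [Fintype ι] [DecidableEq ι] (S : Set (EuclideanSpace ℝ ι)) (η : ℝ)
    (Λ : Matrix ι ι ℝ) (f : EuclideanSpace ℝ ι → ℝ) (z : EuclideanSpace ℝ ι) :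
    EuclideanSpace ℝ ι :=
  weightedProj S Λ (z - η • WithLp.toLp 2 (Λ⁻¹ *ᵥ (gradient f z).ofLp))

/-- Tuning parameters: memory `h`, length `m`, radius `R`, step size `η`, regularization `lam`. -/
structure Config where
  h : ℕ
  m : ℕ
  R : ℝ
  η : ℝ
  lam : ℝ

/-- What the algorithm remembers at the start of round `t`: the current parameter `z_t`, the
preconditioner `Λ_{t-1}`, and the recorded `y^nat_s`, `u^ex_s` for `s < t`. -/
structure Memory (m du dy : ℕ) where
  z : Param m du dy
  Λ : Matrix (Fin m × Fin du × Fin dy) (Fin m × Fin du × Fin dy) ℝ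
  ynat : ℕ → Vec dy
  uex : ℕ → Vec du

/-- Initial memory: `Λ_0 = lam • I` and initial parameter `z₁`. -/
def Memory.init (cfg : Config) (z₁ : Param cfg.m du dy) : Memory cfg.m du dy where
  z := z₁
  Λ := cfg.lam • (1 : Matrix _ _ ℝ)
  ynat := 0
  uex := 0

/-- After observing `y_t`, append `y^nat_t = y_t - ∑_{i<t} G_y^{[t-i]} u^ex_i`, where `G_y` is the
block of the first `d_y` rows of `G`, to the recorded sequence. -/
def Memory.recover {m : ℕ} (G : ℕ → Matrix (Fin dy ⊕ Fin du) (Fin du) ℝ) (S : Memory m du dy)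
    (t : ℕ) (y : Vec dy) : ℕ → Vec dy :=
  Function.update S.ynat t
    (y - ∑ i ∈ Finset.range t, Matrix.toRows₁ (G (t - i)) *ᵥ S.uex i)

/-- The exogenous input `u^ex_t = ∑_{i < m} M_t^{[i]} y^nat_{t-i}`. -/
def Memory.exInput {m : ℕ} (G : ℕ → Matrix (Fin dy ⊕ Fin du) (Fin du) ℝ) (S : Memory m du dy)
    (t : ℕ) (y : Vec dy) : Vec du :=
  embedY m du (S.recover G t y) t *ᵥ S.z.ofLp

/-- The control `u_t = K y_t + u^ex_t` played by the algorithm. -/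
def Memory.control {m : ℕ} (G : ℕ → Matrix (Fin dy ⊕ Fin du) (Fin du) ℝ)
    (K : Matrix (Fin du) (Fin dy) ℝ) (S : Memory m du dy) (t : ℕ) (y : Vec dy) : Vec du :=
  K *ᵥ y + S.exInput G t y

/-- Update after the loss `ℓ` of round `t` is revealed: with
`f_t(z) = ℓ_t((y^nat_t, K y^nat_t) + H_t z)`, put `Λ_t = Λ_{t-1} + H_tᵀ H_t` and take one
projected semi-Newton step. -/
def Memory.update (cfg : Config) (G : ℕ → Matrix (Fin dy ⊕ Fin du) (Fin du) ℝ)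
    (K : Matrix (Fin du) (Fin dy) ℝ) (S : Memory cfg.m du dy) (t : ℕ) (y : Vec dy)
    (ℓ : Sig dy du → ℝ) : Memory cfg.m du dy :=
  let ω := S.recover G t y
  let H := featH cfg.h cfg.m G ω t
  let f : Param cfg.m du dy → ℝ := fun z =>
    ℓ (pair (ω t) (K *ᵥ ω t) + WithLp.toLp 2 (H *ᵥ z.ofLp))
  let Λ := S.Λ + Hᵀ * H
  { z := semiOnsStep (drcSet cfg.m du dy cfg.R) cfg.η Λ f S.z
    Λ := Λ
    ynat := ω
    uex := Function.update S.uex t (S.exInput G t y) }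

/-- The plant state and the algorithm's memory at the start of each round, when DRC-ONS with
known Markov operator `G_K` controls the plant `P` against the losses `ℓ`. -/
def algState (P : Plant dx du dy) (K : Matrix (Fin du) (Fin dy) ℝ) (ℓ : ℕ → Sig dy du → ℝ)
    (cfg : Config) (z₁ : Param cfg.m du dy) : ℕ → Vec dx × Memory cfg.m du dy
  | 0 => (P.x₁, Memory.init cfg z₁)
  | t + 1 =>
    let x := (algState P K ℓ cfg z₁ t).1
    let S := (algState P K ℓ cfg z₁ t).2
    let y := P.C *ᵥ x + P.e t
    (P.A *ᵥ x + P.B *ᵥ S.control (markovK P K) K t y + P.w t,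
      S.update cfg (markovK P K) K t y (ℓ t))

/-- The iterates `(y_t^alg, u_t^alg)` of DRC-ONS. -/
def algIterate (P : Plant dx du dy) (K : Matrix (Fin du) (Fin dy) ℝ) (ℓ : ℕ → Sig dy du → ℝ)
    (cfg : Config) (z₁ : Param cfg.m du dy) (t : ℕ) : Sig dy du :=
  let x := (algState P K ℓ cfg z₁ t).1
  let S := (algState P K ℓ cfg z₁ t).2
  let y := P.C *ᵥ x + P.e t
  pair y (S.control (markovK P K) K t y)

/-- `∑_t ℓ_t(y_t, u_t) - inf_{π ∈ Π} ∑_t ℓ_t(y_t^π, u_t^π)` over `T` rounds for the iterates `v`,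
in the extended reals (so that the infimum over an empty class is `⊤`). -/
def controlRegret (P : Plant dx du dy) (ℓ : ℕ → Sig dy du → ℝ) (T : ℕ) (v : ℕ → Sig dy du)
    (cls : Set (LDC du dy)) : EReal :=
  ((∑ t ∈ Finset.range T, ℓ t (v t) : ℝ) : EReal) -
    ⨅ π ∈ cls, ((∑ t ∈ Finset.range T, ℓ t (ldcIterate P π t) : ℝ) : EReal)

/-- The prescribed parameters: `h = ⌈log T / (1 - ρ_K)⌉`, `m = ⌈log T / (1 - ρ⋆)⌉`,
`R = (1 + ‖K‖_op) c⋆ / (1 - ρ⋆)`, `η = 1/α`, `lam = 6 h R_nat² c_K² / (1 - ρ_K)²`. -/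
def explicitConfig (T : ℕ) (K : Matrix (Fin du) (Fin dy) ℝ) (α Rnat cK ρK cs ρs : ℝ) : Config where
  h := ⌈Real.log T / (1 - ρK)⌉₊
  m := ⌈Real.log T / (1 - ρs)⌉₊
  R := (1 + opNorm K) * (cs / (1 - ρs))
  η := 1 / α
  lam := 6 * (⌈Real.log T / (1 - ρK)⌉₊ : ℝ) * Rnat ^ 2 * (cK / (1 - ρK)) ^ 2

end DrcOns

end

/-! Write every input as u = Ky + u^ex. The iterate is then v^K_t plus the convolution of G_K with
u^ex (`driven_output_eq`), and the recovered y^nat is y^K, whatever has been played (`driven_y_eq`).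
A benchmark controller plays a convolution of y^nat with geometrically decaying matrices
(`ldcEx_eq`). Truncating this to m terms and the response to h terms puts it within order 1/T per
round of a surrogate iterate v^K_t + H_t q with q admissible (`exists_surrogate_le`). The regret
thus splits into this comparison error, the regret of f_t along z_t, and the gap between the true
iterate and v^K_t + H_t z_t.

Strong convexity of ℓ_t in v bounds f_t(z_t) - f_t(q) by a linear term minus (α/2)‖H_t(z_t - q)‖².
With η = 1/α this negative term pays exactly for the change of preconditioner in the potential
(α/2)‖z - q‖²_Λ (`NewtonIterates.regret_le`). What remains is a multiple of the sum of the leverages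
tr(H_t Λ_t⁻¹ H_tᵀ), which telescopes through log det Λ_t to dimension times log(1 + T)
(`sum_lev_le`).

Apart from truncation, the gap comes from past inputs having used older parameters. No Euclidean
bound on the movement of z is needed, only one on Y_s(z_t - z_s). Since [-K I] recovers u^ex from
(y, u), ‖Y_s x‖ ≤ (1 + ‖K‖)‖H_s x‖ (`nrm_embedY_le_featH`). A Newton step at a time t ≥ s moves H_s
z by at most γ/α times the geometric mean of the leverages at s and t (`movement_le`). The drift is
therefore also summed by log det, with the delays absorbed by the decay of G_K (`sum_delayed_le`).

With rounds counted from 0, `Λ t` precedes round t, and `Λ (t + 1)` already contains H_tᵀ H_t. -/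

namespace DrcOns

/-! ### Euclidean norms of coordinate vectors -/

section Norms

variable {ι κ : Type*} [Fintype ι] [Fintype κ]

/-- The Euclidean norm of a coordinate vector. -/
noncomputable def nrm (x : ι → ℝ) : ℝ := ‖WithLp.toLp 2 x‖

lemma nrm_ofLp (x : EuclideanSpace ℝ ι) : nrm x.ofLp = ‖x‖ := rfl

lemma nrm_nonneg (x : ι → ℝ) : 0 ≤ nrm x := norm_nonneg _

@[simp] lemma nrm_zero : nrm (0 : ι → ℝ) = 0 := by simp [nrm]

lemma nrm_add_le (x y : ι → ℝ) : nrm (x + y) ≤ nrm x + nrm y := by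
  simpa [nrm] using norm_add_le (WithLp.toLp 2 x) (WithLp.toLp 2 y)

lemma nrm_sub_le (x y : ι → ℝ) : nrm (x - y) ≤ nrm x + nrm y := by
  simpa [nrm] using norm_sub_le (WithLp.toLp 2 x) (WithLp.toLp 2 y)

lemma nrm_neg (x : ι → ℝ) : nrm (-x) = nrm x := by simp [nrm]

lemma nrm_sum_le {σ : Type*} (s : Finset σ) (f : σ → ι → ℝ) :
    nrm (∑ i ∈ s, f i) ≤ ∑ i ∈ s, nrm (f i) := by
  simpa [nrm] using norm_sum_le s fun i => WithLp.toLp 2 (f i)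

lemma nrm_sq_eq_sum (x : ι → ℝ) : nrm x ^ 2 = ∑ i, x i ^ 2 := by
  simp [nrm, EuclideanSpace.norm_sq_eq]

lemma nrm_sq (x : ι → ℝ) : nrm x ^ 2 = x ⬝ᵥ x := by
  rw [nrm_sq_eq_sum]; simp [dotProduct, sq]

lemma inner_eq_dotProduct (x y : EuclideanSpace ℝ ι) : inner ℝ x y = x.ofLp ⬝ᵥ y.ofLp := by
  rw [EuclideanSpace.inner_eq_star_dotProduct, dotProduct_comm]; simp

lemma abs_le_nrm (x : ι → ℝ) (i : ι) : |x i| ≤ nrm x := by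
  simpa [nrm] using PiLp.norm_apply_le (WithLp.toLp 2 x) i

lemma nrm_sumElim (x : ι → ℝ) (y : κ → ℝ) : nrm (Sum.elim x y) ^ 2 = nrm x ^ 2 + nrm y ^ 2 := by
  simp [nrm_sq_eq_sum]

lemma nrm_single [DecidableEq ι] (i : ι) (c : ℝ) : nrm (Pi.single i c : ι → ℝ) = |c| := by
  have : nrm (Pi.single i c : ι → ℝ) ^ 2 = |c| ^ 2 := by
    rw [nrm_sq]; simp [sq]
  exact (pow_left_inj₀ (nrm_nonneg _) (abs_nonneg _) two_ne_zero).1 this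

variable [DecidableEq κ]

lemma opNorm_nonneg (M : Matrix ι κ ℝ) : 0 ≤ opNorm M := norm_nonneg _

lemma nrm_mulVec_le (M : Matrix ι κ ℝ) (x : κ → ℝ) : nrm (M *ᵥ x) ≤ opNorm M * nrm x :=
  (LinearMap.toContinuousLinearMap (Matrix.toEuclideanLin M)).le_opNorm (WithLp.toLp 2 x)

lemma opNorm_le_of_nrm {M : Matrix ι κ ℝ} {c : ℝ} (hc : 0 ≤ c)
    (h : ∀ x, nrm (M *ᵥ x) ≤ c * nrm x) : opNorm M ≤ c :=
  ContinuousLinearMap.opNorm_le_bound _ hc fun x => h x.ofLp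

lemma abs_entry_le_opNorm (M : Matrix ι κ ℝ) (i : ι) (j : κ) : |M i j| ≤ opNorm M := by
  have h := (abs_le_nrm _ i).trans (nrm_mulVec_le M (Pi.single j 1))
  simpa [nrm_single] using h

lemma opNorm_add_le (M N : Matrix ι κ ℝ) : opNorm (M + N) ≤ opNorm M + opNorm N :=
  opNorm_le_of_nrm (add_nonneg (opNorm_nonneg _) (opNorm_nonneg _)) fun x => by
    rw [add_mulVec, add_mul]
    exact (nrm_add_le _ _).trans (add_le_add (nrm_mulVec_le _ _) (nrm_mulVec_le _ _))

lemma opNorm_smul (c : ℝ) (M : Matrix ι κ ℝ) : opNorm (c • M) = |c| * opNorm M := by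
  simp [opNorm, norm_smul]

lemma continuous_opNorm : Continuous (opNorm : Matrix ι κ ℝ → ℝ) := by
  have h : Continuous fun M : Matrix ι κ ℝ =>
      LinearMap.toContinuousLinearMap (Matrix.toEuclideanLin M) :=
    LinearMap.continuous_of_finiteDimensional
      ((LinearMap.toContinuousLinearMap (𝕜 := ℝ) (E := EuclideanSpace ℝ κ)
        (F' := EuclideanSpace ℝ ι)).toLinearMap ∘ₗ (Matrix.toEuclideanLin).toLinearMap)
  exact continuous_norm.comp h

end Norms

/-! ### Leverage scores and determinants -/

section Leverage

variable {ι κ : Type*} [Fintype ι] [Fintype κ]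

/-- Cauchy–Schwarz on each row: the Frobenius norm dominates the operator norm. -/
lemma nrm_mulVec_sq_le_trace (M : Matrix κ ι ℝ) (x : ι → ℝ) :
    nrm (M *ᵥ x) ^ 2 ≤ (M * Mᵀ).trace * nrm x ^ 2 := by
  simp only [nrm_sq_eq_sum, trace, diag, mul_apply, transpose_apply, Finset.sum_mul]
  refine Finset.sum_le_sum fun i _ => ?_
  have := Finset.sum_mul_sq_le_sq_mul_sq Finset.univ (M i) x
  simp only [mulVec, dotProduct]
  simpa [Finset.sum_mul, sq] using this

lemma posDef_add_transpose_mul_self {Λ : Matrix ι ι ℝ} (h : Λ.PosDef) (H : Matrix κ ι ℝ) :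
    (Λ + Hᵀ * H).PosDef := by
  have := posSemidef_conjTranspose_mul_self H
  rw [conjTranspose_eq_transpose_of_trivial] at this
  exact h.add_posSemidef this

variable [DecidableEq ι]

lemma exists_eq_transpose_mul_self {Λ : Matrix ι ι ℝ} (h : Λ.PosSemidef) :
    ∃ E : Matrix ι ι ℝ, Λ = Eᵀ * E := by
  open scoped MatrixOrder in
  obtain ⟨E, hE⟩ := CStarAlgebra.nonneg_iff_eq_star_mul_self.mp h.nonneg
  exact ⟨E, by simpa [star_eq_conjTranspose, conjTranspose_eq_transpose_of_trivial] using hE⟩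

/-- An arbitrary factor E with inverse F serves in place of the symmetric square root of Λ. -/
lemma posDef_factor {Λ : Matrix ι ι ℝ} (h : Λ.PosDef) :
    ∃ E F : Matrix ι ι ℝ, Λ = Eᵀ * E ∧ F * E = 1 ∧ Λ⁻¹ = F * Fᵀ := by
  obtain ⟨E, hE⟩ := exists_eq_transpose_mul_self h.posSemidef
  have hdet : IsUnit E.det := by
    have := h.det_pos
    rw [hE, det_mul, det_transpose] at this
    exact isUnit_iff_ne_zero.2 fun h0 => by simp [h0] at this
  refine ⟨E, E⁻¹, hE, nonsing_inv_mul _ hdet, ?_⟩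
  rw [hE, Matrix.mul_inv_rev, transpose_nonsing_inv]

/-- The leverage `tr (H Λ⁻¹ Hᵀ)` of a feature matrix. -/
noncomputable def lev (Λ : Matrix ι ι ℝ) (H : Matrix κ ι ℝ) : ℝ := (H * Λ⁻¹ * Hᵀ).trace

lemma lev_nonneg {Λ : Matrix ι ι ℝ} (h : Λ.PosDef) (H : Matrix κ ι ℝ) : 0 ≤ lev Λ H := by
  have := (h.inv.posSemidef.mul_mul_conjTranspose_same H).trace_nonneg
  simpa [lev, conjTranspose_eq_transpose_of_trivial] using this

/-- Since Hx = (HF)(Ex), the Frobenius bound applies: HF has squared Frobenius norm equal to the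
leverage, and ‖Ex‖² is the Λ-form. -/
lemma nrm_mulVec_sq_le_lev {Λ : Matrix ι ι ℝ} (h : Λ.PosDef) (H : Matrix κ ι ℝ) (x : ι → ℝ) :
    nrm (H *ᵥ x) ^ 2 ≤ lev Λ H * (x ⬝ᵥ Λ *ᵥ x) := by
  obtain ⟨E, F, hE, hFE, hF⟩ := posDef_factor h
  have h1 := nrm_mulVec_sq_le_trace (H * F) (E *ᵥ x)
  rw [mulVec_mulVec, Matrix.mul_assoc, hFE, Matrix.mul_one, nrm_sq (E *ᵥ x)] at h1
  convert h1 using 2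
  · rw [lev, hF, transpose_mul]; simp only [Matrix.mul_assoc]
  · rw [hE, ← mulVec_mulVec, dotProduct_mulVec, vecMul_transpose]

lemma dotProduct_inv_mulVec_le_lev {Λ : Matrix ι ι ℝ} (h : Λ.PosDef)
    (H : Matrix κ ι ℝ) (g : κ → ℝ) :
    (Hᵀ *ᵥ g) ⬝ᵥ Λ⁻¹ *ᵥ (Hᵀ *ᵥ g) ≤ lev Λ H * nrm g ^ 2 := by
  obtain ⟨E, F, hE, hFE, hF⟩ := posDef_factor h
  have h1 := nrm_mulVec_sq_le_trace (Fᵀ * Hᵀ) g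
  rw [nrm_sq (_ *ᵥ g)] at h1
  have e1 : (Hᵀ *ᵥ g) ⬝ᵥ Λ⁻¹ *ᵥ (Hᵀ *ᵥ g) = (Fᵀ * Hᵀ) *ᵥ g ⬝ᵥ (Fᵀ * Hᵀ) *ᵥ g := by
    rw [hF, ← mulVec_mulVec, dotProduct_mulVec, ← mulVec_transpose, mulVec_mulVec]
  have e2 : lev Λ H = (Fᵀ * Hᵀ * (Fᵀ * Hᵀ)ᵀ).trace := by
    rw [lev, hF, transpose_mul Fᵀ, transpose_transpose, transpose_transpose,
      trace_mul_comm (Fᵀ * Hᵀ)]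
    simp only [Matrix.mul_assoc]
  rwa [e1, e2]

/-- Multiply μ ≤ exp(μ - 1) over the eigenvalues. -/
lemma det_le_exp_trace_sub_card {X : Matrix ι ι ℝ} (h : X.PosSemidef) :
    X.det ≤ Real.exp (X.trace - Fintype.card ι) := by
  rw [h.1.det_eq_prod_eigenvalues, h.1.trace_eq_sum_eigenvalues]
  have : (∑ i, ((h.1.eigenvalues i : ℝ) : ℝ)) - Fintype.card ι = ∑ i, (h.1.eigenvalues i - 1) := by
    simp
  simp only [RCLike.ofReal_real_eq_id, id] at *
  rw [this, Real.exp_sum]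
  refine Finset.prod_le_prod (fun i _ => h.eigenvalues_nonneg i) fun i _ => ?_
  have := Real.add_one_le_exp (h.1.eigenvalues i - 1)
  linarith

/-- PQ need not be symmetric, but with Q = BᵀB the positive semidefinite matrix BPBᵀ has the same
determinant and trace. -/
lemma det_mul_det_le {P Q : Matrix ι ι ℝ} (hP : P.PosSemidef) (hQ : Q.PosSemidef) :
    P.det * Q.det ≤ Real.exp ((P * Q).trace - Fintype.card ι) := by
  obtain ⟨B, rfl⟩ := exists_eq_transpose_mul_self hQ
  have h := det_le_exp_trace_sub_card (hP.mul_mul_conjTranspose_same B)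
  rw [conjTranspose_eq_transpose_of_trivial] at h
  rw [← Matrix.mul_assoc, trace_mul_comm, ← Matrix.mul_assoc]
  refine le_trans (le_of_eq ?_) h
  simp only [det_mul, det_transpose]; ring

/-- Concavity of log det: with N = Λ + HᵀH, the trace of N⁻¹Λ is the dimension minus the leverage,
so `det_mul_det_le` for N⁻¹ and Λ gives the claim after taking logarithms. -/
lemma lev_le_log_det_sub {Λ : Matrix ι ι ℝ} (h : Λ.PosDef) (H : Matrix κ ι ℝ) :
    lev (Λ + Hᵀ * H) H ≤ Real.log (Λ + Hᵀ * H).det - Real.log Λ.det := by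
  have hp := posDef_add_transpose_mul_self h H
  set N := Λ + Hᵀ * H with hN
  have h1 := det_mul_det_le hp.inv.posSemidef h.posSemidef
  have h2 : N⁻¹ * Λ = 1 - N⁻¹ * (Hᵀ * H) := by
    have : Λ = N - Hᵀ * H := by simp [hN]
    rw [this, Matrix.mul_sub, nonsing_inv_mul _ hp.det_pos.ne'.isUnit]
  have h3 : (N⁻¹ * (Hᵀ * H)).trace = lev N H := by
    rw [lev, ← Matrix.mul_assoc, trace_mul_comm, ← Matrix.mul_assoc]
  rw [h2, trace_sub, trace_one, h3, det_nonsing_inv, Ring.inverse_eq_inv'] at h1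
  have h4 := Real.log_le_log (mul_pos (inv_pos.2 hp.det_pos) h.det_pos) h1
  rw [Real.log_exp, Real.log_mul (inv_pos.2 hp.det_pos).ne' h.det_pos.ne', Real.log_inv] at h4
  linarith

lemma log_det_le {Λ : Matrix ι ι ℝ} (h : Λ.PosDef) {c : ℝ} (hc : 0 < c)
    (htr : Λ.trace ≤ c * Fintype.card ι) : Real.log Λ.det ≤ Fintype.card ι * Real.log c := by
  have hP : (c⁻¹ • (1 : Matrix ι ι ℝ)).PosSemidef := PosSemidef.one.smul (inv_pos.2 hc).le
  have h1 := det_mul_det_le hP h.posSemidef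
  rw [det_smul, det_one, mul_one, smul_mul, Matrix.one_mul, trace_smul, smul_eq_mul] at h1
  have h2 : c⁻¹ * Λ.trace - Fintype.card ι ≤ 0 := by
    rw [sub_nonpos, inv_mul_le_iff₀ hc]; exact htr
  have h3 := h1.trans (Real.exp_le_one_iff.2 h2)
  rw [inv_pow, inv_mul_le_iff₀ (by positivity), mul_one] at h3
  have := Real.log_le_log h.det_pos h3
  rwa [Real.log_pow] at this

end Leverage

/-! ### Regular losses -/

section Loss

variable {dy du : ℕ} {L α : ℝ} {ℓ : Sig dy du → ℝ}

/-- Divide the strong convexity inequality on the segment from v to w by s and let s decrease to 0.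
-/
lemma LossRegular.add_inner_le (h : LossRegular L α ℓ) (v w : Sig dy du) :
    ℓ v + inner ℝ (gradient ℓ v) (w - v) + α / 2 * ‖w - v‖ ^ 2 ≤ ℓ w := by
  have hd : HasDerivAt (fun s : ℝ => ℓ (v + s • (w - v))) (inner ℝ (gradient ℓ v) (w - v)) 0 := by
    have h1 : HasFDerivAt ℓ (InnerProductSpace.toDual ℝ _ (gradient ℓ v))
        (v + (0 : ℝ) • (w - v)) := by
      simpa using (h.differentiable v).hasGradientAt.hasFDerivAt
    have h2 : HasDerivAt (fun s : ℝ => v + s • (w - v)) (w - v) 0 := by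
      simpa using ((hasDerivAt_id (0 : ℝ)).smul_const (w - v)).const_add v
    exact h1.comp_hasDerivAt (0 : ℝ) h2
  have ht := hd.tendsto_slope_zero_right
  have hu : Filter.Tendsto (fun s : ℝ => ℓ w - ℓ v - (1 - s) * (α / 2 * ‖w - v‖ ^ 2))
      (nhdsWithin 0 (Set.Ioi 0)) (nhds (ℓ w - ℓ v - (1 - 0) * (α / 2 * ‖w - v‖ ^ 2))) :=
    (Continuous.tendsto (by fun_prop) 0).mono_left nhdsWithin_le_nhds
  have := le_of_tendsto_of_tendsto ht hu ?_
  · linarith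
  filter_upwards [Ioo_mem_nhdsGT (zero_lt_one' ℝ)] with s hs
  have hc := h.strongConvex.2 (Set.mem_univ v) (Set.mem_univ w) (sub_nonneg.2 hs.2.le) hs.1.le
    (by ring)
  have e : (1 - s) • v + s • w = v + s • (w - v) := by module
  rw [e, norm_sub_rev] at hc
  simp only [smul_eq_mul, zero_add, zero_smul, add_zero] at hc ⊢
  rw [inv_mul_le_iff₀ hs.1]
  linarith

/-- Convexity needs only the gradient at v, so w may be unbounded; in particular, benchmark
trajectories need no norm bound. -/
lemma LossRegular.sub_le (h : LossRegular L α ℓ) (hα : 0 < α) {r : ℝ} (hr : 1 ≤ r)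
    {v w : Sig dy du} (hv : ‖v‖ ≤ r) : ℓ v - ℓ w ≤ L * r * ‖v - w‖ := by
  have hL : 0 ≤ L := by
    have h1 := (h.nonneg 0).trans (h.le 0)
    simpa using h1
  have h1 := h.add_inner_le v w
  have h2 := real_inner_le_norm (gradient ℓ v) (v - w)
  have h3 : inner ℝ (gradient ℓ v) (w - v) = - inner ℝ (gradient ℓ v) (v - w) := by
    rw [← inner_neg_right, neg_sub]
  have h4 : ‖gradient ℓ v‖ * ‖v - w‖ ≤ L * r * ‖v - w‖ := by
    refine mul_le_mul_of_nonneg_right ((h.gradient_le v).trans ?_) (norm_nonneg _)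
    exact mul_le_mul_of_nonneg_left (max_le hr hv) hL
  have : 0 ≤ α / 2 * ‖w - v‖ ^ 2 := by positivity
  linarith

lemma LossRegular.nonneg_const (h : LossRegular L α ℓ) : 0 ≤ L := by
  simpa using (h.nonneg 0).trans (h.le 0)

/-- In the sum of the first-order inequalities between v and -v the values cancel, leaving 4α ≤ 4L.
This later absorbs terms linear in L or α into L²/α. -/
lemma LossRegular.le_const (h : LossRegular L α ℓ) {v : Sig dy du} (hv : ‖v‖ = 1) : α ≤ L := by
  have h1 := h.add_inner_le v (-v)
  have h2 := h.add_inner_le (-v) v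
  have e1 : -v - v = (-2 : ℝ) • v := by module
  have e2 : v - -v = (2 : ℝ) • v := by module
  rw [e1, inner_smul_right, norm_smul, hv] at h1
  rw [e2, inner_smul_right, norm_smul, hv] at h2
  have h3 := abs_le.1 (abs_real_inner_le_norm (gradient ℓ v) v)
  have h4 := abs_le.1 (abs_real_inner_le_norm (gradient ℓ (-v)) v)
  have h5 := h.gradient_le v
  have h6 := h.gradient_le (-v)
  rw [norm_neg] at h6
  norm_num [hv] at h1 h2 h3 h4 h5 h6
  linarith

end Loss

/-! ### Markov expansions of the closed-loop dynamics -/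

section Dynamics

variable {dx du dy : ℕ}

lemma linear_recursion_eq_sum {σ : Type*} [Fintype σ] [DecidableEq σ] (F : Matrix σ σ ℝ)
    (g δ : ℕ → σ → ℝ) (h0 : δ 0 = 0) (hs : ∀ t, δ (t + 1) = F *ᵥ δ t + g t) (t : ℕ) :
    δ t = ∑ i ∈ Finset.range t, (F ^ i) *ᵥ g (t - 1 - i) := by
  induction t with
  | zero => simpa using h0
  | succ t ih =>
    rw [hs, ih, Finset.sum_range_succ', mulVec_sum]
    simp only [pow_succ', ← mulVec_mulVec]
    simp [Nat.sub_sub, Nat.add_comm]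

/-- The state trajectory under `u = K y`. -/
noncomputable def natX (P : Plant dx du dy) (K : Matrix (Fin du) (Fin dy) ℝ) (t : ℕ) : Vec dx :=
  (ldcState P (LDC.static K) t).1

/-- The outputs under `u = K y`. -/
noncomputable def natY (P : Plant dx du dy) (K : Matrix (Fin du) (Fin dy) ℝ) (t : ℕ) : Vec dy :=
  P.C *ᵥ natX P K t + P.e t

lemma natX_succ (P : Plant dx du dy) (K : Matrix (Fin du) (Fin dy) ℝ) (t : ℕ) :
    natX P K (t + 1) = P.A *ᵥ natX P K t + P.B *ᵥ (K *ᵥ natY P K t) + P.w t := by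
  have h (s : Vec (LDC.static K).dim) (u : Vec du) : (LDC.static K).C *ᵥ s + u = u := by
    rw [show (LDC.static K).C *ᵥ s = 0 from zero_mulVec s, zero_add]
  rw [natX, ldcState, h]
  rfl

lemma natIterate_eq (P : Plant dx du dy) (K : Matrix (Fin du) (Fin dy) ℝ) (t : ℕ) :
    natIterate P K t = pair (natY P K t) (K *ᵥ natY P K t) := by
  have h (s : Vec (LDC.static K).dim) (u : Vec du) : (LDC.static K).C *ᵥ s + u = u := by
    rw [show (LDC.static K).C *ᵥ s = 0 from zero_mulVec s, zero_add]
  rw [natIterate, ldcIterate, h]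
  rfl

/-- In the difference from the trajectory under u = Ky, the initial state and both disturbances
cancel, leaving a linear recursion driven by u^ex alone. -/
lemma driven_state_eq (P : Plant dx du dy) (K : Matrix (Fin du) (Fin dy) ℝ) (x : ℕ → Vec dx)
    (ue : ℕ → Vec du) (h0 : x 0 = P.x₁)
    (hs : ∀ t, x (t + 1) =
      P.A *ᵥ x t + P.B *ᵥ (K *ᵥ (P.C *ᵥ x t + P.e t) + ue t) + P.w t) (t : ℕ) :
    x t = natX P K t + ∑ i ∈ Finset.range t,
      ((P.A + P.B * K * P.C) ^ i * P.B) *ᵥ ue (t - 1 - i) := by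
  have h := linear_recursion_eq_sum (P.A + P.B * K * P.C) (fun t => P.B *ᵥ ue t)
    (fun t => x t - natX P K t) (by simp [h0, natX, ldcState]) (fun t => ?_) t
  · simp only [← mulVec_mulVec]
    rw [← h]; abel
  · simp only [hs, natX_succ, natY, add_mulVec, mulVec_add, mulVec_sub, ← mulVec_mulVec]
    abel

lemma driven_output_eq (P : Plant dx du dy) (K : Matrix (Fin du) (Fin dy) ℝ) (x : ℕ → Vec dx)
    (ue : ℕ → Vec du) (h0 : x 0 = P.x₁)
    (hs : ∀ t, x (t + 1) =
      P.A *ᵥ x t + P.B *ᵥ (K *ᵥ (P.C *ᵥ x t + P.e t) + ue t) + P.w t) (t : ℕ) :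
    pair (P.C *ᵥ x t + P.e t) (K *ᵥ (P.C *ᵥ x t + P.e t) + ue t) = natIterate P K t +
      WithLp.toLp 2 (∑ i ∈ Finset.range (t + 1), markovK P K i *ᵥ ue (t - i)) := by
  have hx : P.C *ᵥ x t + P.e t = natY P K t + ∑ i ∈ Finset.range t,
      P.C *ᵥ ((P.A + P.B * K * P.C) ^ i * P.B) *ᵥ ue (t - 1 - i) := by
    rw [driven_state_eq P K x ue h0 hs t, mulVec_add, mulVec_sum, natY]; abel
  rw [hx, natIterate_eq, pair, pair, ← WithLp.toLp_add]
  congr 1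
  have hM : ∀ i, markovK P K (i + 1) *ᵥ ue (t - (i + 1)) =
      Sum.elim (P.C *ᵥ ((P.A + P.B * K * P.C) ^ i * P.B) *ᵥ ue (t - 1 - i))
        (K *ᵥ P.C *ᵥ ((P.A + P.B * K * P.C) ^ i * P.B) *ᵥ ue (t - 1 - i)) := by
    intro i
    rw [markovK, Matrix.mul_assoc, ← mulVec_mulVec, fromRows_mulVec, ← mulVec_mulVec _ K,
      Nat.sub_sub, Nat.add_comm 1 i]
  rw [Finset.sum_range_succ', Finset.sum_congr rfl fun i _ => hM i, markovK, fromRows_mulVec,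
    zero_mulVec, one_mulVec]
  simp only [mulVec_add, mulVec_sum]
  funext j
  rcases j with j | j <;> simp [Finset.sum_apply, add_assoc]

lemma driven_y_eq (P : Plant dx du dy) (K : Matrix (Fin du) (Fin dy) ℝ) (x : ℕ → Vec dx)
    (ue : ℕ → Vec du) (h0 : x 0 = P.x₁)
    (hs : ∀ t, x (t + 1) =
      P.A *ᵥ x t + P.B *ᵥ (K *ᵥ (P.C *ᵥ x t + P.e t) + ue t) + P.w t) (t : ℕ) :
    P.C *ᵥ x t + P.e t -
      ∑ i ∈ Finset.range t, toRows₁ (markovK P K (t - i)) *ᵥ ue i = natY P K t := by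
  have hx : P.C *ᵥ x t + P.e t = natY P K t + ∑ i ∈ Finset.range t,
      P.C *ᵥ ((P.A + P.B * K * P.C) ^ i * P.B) *ᵥ ue (t - 1 - i) := by
    rw [driven_state_eq P K x ue h0 hs t, mulVec_add, mulVec_sum, natY]; abel
  rw [hx, sub_eq_iff_eq_add, add_right_inj,
    ← Finset.sum_range_reflect fun i => toRows₁ (markovK P K (t - i)) *ᵥ ue i]
  refine Finset.sum_congr rfl fun i hi => ?_
  have hi := Finset.mem_range.1 hi
  have e : t - (t - 1 - i) = i + 1 := by omega
  have hr : toRows₁ (markovK P K (i + 1)) = P.C * ((P.A + P.B * K * P.C) ^ i * P.B) := by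
    rw [markovK, Matrix.mul_assoc, fromRows_mul, toRows₁_fromRows]
  rw [e, hr, mulVec_mulVec]

/-- The disturbance-response matrices generated by a linear dynamic controller. -/
noncomputable def responseMat (P : Plant dx du dy) (K : Matrix (Fin du) (Fin dy) ℝ) (π : LDC du dy)
    (i : ℕ) : Matrix (Fin du) (Fin dy) ℝ :=
  markovCl P K π i * (fromRows 1 K : Matrix (Fin dy ⊕ Fin du) (Fin dy) ℝ) - if i = 0 then K else 0

/-- The exogenous input played by a linear dynamic controller on top of `u = K y`. -/
noncomputable def ldcEx (P : Plant dx du dy) (K : Matrix (Fin du) (Fin dy) ℝ) (π : LDC du dy)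
    (t : ℕ) : Vec du :=
  π.C *ᵥ (ldcState P π t).2 + π.D *ᵥ (P.C *ᵥ (ldcState P π t).1 + P.e t) -
    K *ᵥ (P.C *ᵥ (ldcState P π t).1 + P.e t)

lemma ldcIterate_eq (P : Plant dx du dy) (K : Matrix (Fin du) (Fin dy) ℝ) (π : LDC du dy) (t : ℕ) :
    ldcIterate P π t = natIterate P K t +
      WithLp.toLp 2 (∑ i ∈ Finset.range (t + 1), markovK P K i *ᵥ ldcEx P K π (t - i)) := by
  rw [← driven_output_eq P K (fun t => (ldcState P π t).1) (ldcEx P K π) rfl]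
  · simp [ldcIterate, ldcEx]
  · intro t
    simp [ldcState, ldcEx]

/-- The deviation (x^π - x^K, s^π) starts at 0 and is driven through the closed-loop matrix by (y^K,
K y^K). The feedthrough (D_π - K) y^K is the lag-0 term, which explains the correction by K in
`responseMat`. -/
lemma ldcEx_eq (P : Plant dx du dy) (K : Matrix (Fin du) (Fin dy) ℝ) (π : LDC du dy) (t : ℕ) :
    ldcEx P K π t = ∑ i ∈ Finset.range (t + 1), responseMat P K π i *ᵥ natY P K (t - i) := by
  set v : ℕ → (Fin dy ⊕ Fin du → ℝ) := fun t => Sum.elim (natY P K t) (K *ᵥ natY P K t) with hv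
  have h := linear_recursion_eq_sum
    (fromBlocks (P.A + P.B * π.D * P.C) (P.B * π.C) (π.B * P.C) π.A)
    (fun t => fromBlocks (P.B * π.D) (-P.B) π.B 0 *ᵥ v t)
    (fun t => Sum.elim ((ldcState P π t).1 - natX P K t) (ldcState P π t).2) ?_ ?_ t
  · have h1 : ldcEx P K π t = fromCols ((π.D - K) * P.C) π.C *ᵥ
        Sum.elim ((ldcState P π t).1 - natX P K t) (ldcState P π t).2 +
          (π.D *ᵥ natY P K t - K *ᵥ natY P K t) := by
      rw [fromCols_mulVec_sumElim, ldcEx, natY]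
      simp only [← mulVec_mulVec, mulVec_add, mulVec_sub, sub_mulVec]
      abel
    have h2 : ∀ i, markovCl P K π i *ᵥ v (t - i) =
        (markovCl P K π i * (fromRows 1 K : Matrix (Fin dy ⊕ Fin du) (Fin dy) ℝ)) *ᵥ natY P K (t - i) := by
      intro i
      rw [← mulVec_mulVec, fromRows_mulVec, one_mulVec]
    rw [h1, h, Finset.sum_range_succ', mulVec_sum]
    congr 1
    · refine Finset.sum_congr rfl fun i _ => ?_
      rw [responseMat, if_neg (Nat.succ_ne_zero i), sub_zero, ← h2, markovCl, Nat.sub_sub,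
        Nat.add_comm 1 i, ← mulVec_mulVec, ← mulVec_mulVec]
    · rw [responseMat, sub_mulVec, ← h2, markovCl, if_pos rfl, Nat.sub_zero,
        fromCols_mulVec_sumElim, zero_mulVec, add_zero]
  · funext j
    rcases j with j | j <;> simp [ldcState, natX]
  · intro t
    simp only [hv, fromBlocks_mulVec, Sum.elim_comp_inl, Sum.elim_comp_inr]
    rw [natX_succ, ldcState]
    have hy : P.C *ᵥ (ldcState P π t).1 + P.e t =
        P.C *ᵥ ((ldcState P π t).1 - natX P K t) + natY P K t := by
      rw [natY, mulVec_sub]; abel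
    simp only [hy]
    generalize natY P K t = y
    generalize ldcState P π t = q
    obtain ⟨x, s⟩ := q
    funext j
    rcases j with j | j
    · simp only [add_mulVec, mulVec_add, mulVec_sub, ← mulVec_mulVec, neg_mulVec, Sum.elim_inl,
        Pi.add_apply, Pi.sub_apply, Pi.neg_apply]
      ring
    · simp only [mulVec_add, mulVec_sub, ← mulVec_mulVec, zero_mulVec, Sum.elim_inr,
        Pi.add_apply, Pi.sub_apply, Pi.zero_apply]
      ring

lemma nrm_fromRows_one_mulVec_le (K : Matrix (Fin du) (Fin dy) ℝ) (x : Vec dy) :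
    nrm ((fromRows 1 K : Matrix (Fin dy ⊕ Fin du) (Fin dy) ℝ) *ᵥ x) ≤ (1 + opNorm K) * nrm x := by
  have hK := opNorm_nonneg K
  have hx := nrm_nonneg x
  refine abs_le_of_sq_le_sq' ?_ (by positivity) |>.2
  rw [fromRows_mulVec, one_mulVec, nrm_sumElim]
  have h1 := pow_le_pow_left₀ (nrm_nonneg _) (nrm_mulVec_le K x) 2
  nlinarith [mul_nonneg hK (sq_nonneg (nrm x))]

lemma opNorm_responseMat_le (P : Plant dx du dy) (K : Matrix (Fin du) (Fin dy) ℝ) {c ρ : ℝ}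
    (hc : 1 ≤ c) (hρ : 0 < ρ) {π : LDC du dy} (hπ : π ∈ stabClass P K c ρ) (i : ℕ) :
    opNorm (responseMat P K π i) ≤ (1 + opNorm K) * c * ρ ^ i := by
  have hK := opNorm_nonneg K
  refine opNorm_le_of_nrm (by positivity) fun x => ?_
  have hx := nrm_nonneg x
  rcases i with _ | i
  · have h1 : responseMat P K π 0 *ᵥ x = markovCl P K π 0 *ᵥ Sum.elim x 0 - K *ᵥ x := by
      rw [responseMat, sub_mulVec, ← mulVec_mulVec, markovCl, fromRows_mulVec, one_mulVec,
        fromCols_mulVec_sumElim, fromCols_mulVec_sumElim]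
      simp
    have h2 : nrm (Sum.elim x (0 : Vec du)) = nrm x := by
      have := nrm_sumElim x (0 : Vec du)
      rw [nrm_zero, zero_pow two_ne_zero, add_zero] at this
      exact (pow_left_inj₀ (nrm_nonneg _) hx two_ne_zero).1 this
    rw [h1]
    refine (nrm_sub_le _ _).trans ((add_le_add (nrm_mulVec_le _ _) (nrm_mulVec_le _ _)).trans ?_)
    rw [h2]
    -- At lag 0 the matrix is D_π - K, bounded by c + ‖K‖ ≤ (1 + ‖K‖)c; this uses c ≥ 1.
    have h3 := mul_le_mul_of_nonneg_right (hπ 0) hx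
    have h4 := mul_le_mul_of_nonneg_right (mul_le_mul_of_nonneg_left hc hK) hx
    simp only [pow_zero, mul_one] at h3 h4 ⊢
    linarith
  · rw [responseMat, if_neg (Nat.succ_ne_zero i), sub_zero, ← mulVec_mulVec]
    refine (nrm_mulVec_le _ _).trans ?_
    calc _ ≤ (c * ρ ^ (i + 1)) * ((1 + opNorm K) * nrm x) :=
          mul_le_mul (hπ _) (nrm_fromRows_one_mulVec_le K x) (nrm_nonneg _) (by positivity)
      _ = _ := by ring

end Dynamics

/-! ### The trajectory of the algorithm -/

section Algorithm

variable {dx du dy m : ℕ}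

lemma embedY_mulVec (ω : ℕ → Vec dy) (t : ℕ) (z : Param m du dy) :
    embedY m du ω t *ᵥ z.ofLp =
      ∑ i : Fin m, if (i : ℕ) ≤ t then z.mat i *ᵥ ω (t - i) else 0 := by
  funext a
  simp only [mulVec, dotProduct, embedY, of_apply, Fintype.sum_prod_type, Finset.sum_apply]
  refine Finset.sum_congr rfl fun i _ => ?_
  rw [Finset.sum_eq_single a]
  · by_cases h : (i : ℕ) ≤ t <;> simp [h, Param.mat, mulVec, dotProduct, mul_comm]
  · intro b _ hb; simp [hb.symm]
  · simp

lemma embedY_congr {ω ω' : ℕ → Vec dy} {t : ℕ} (h : ∀ s ≤ t, ω s = ω' s) :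
    embedY m du ω t = embedY m du ω' t := by
  ext a j
  simp only [embedY, of_apply]
  rw [h _ (Nat.sub_le _ _)]

lemma featH_congr {hor : ℕ} {G : ℕ → Matrix (Fin dy ⊕ Fin du) (Fin du) ℝ} {ω ω' : ℕ → Vec dy}
    {t : ℕ} (h : ∀ s ≤ t, ω s = ω' s) : featH hor m G ω t = featH hor m G ω' t := by
  rw [featH, featH]
  refine Finset.sum_congr rfl fun i _ => ?_
  rw [embedY_congr fun s hs => h s (hs.trans (Nat.sub_le _ _))]

variable (P : Plant dx du dy) (K : Matrix (Fin du) (Fin dy) ℝ) (ℓ : ℕ → Sig dy du → ℝ)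
  (cfg : Config) (z₁ : Param cfg.m du dy)

/-- The output observed by the algorithm. -/
noncomputable def algY (t : ℕ) : Vec dy :=
  P.C *ᵥ (algState P K ℓ cfg z₁ t).1 + P.e t

/-- The exogenous input of the algorithm. -/
noncomputable def algEx (t : ℕ) : Vec du :=
  (algState P K ℓ cfg z₁ t).2.exInput (markovK P K) t (algY P K ℓ cfg z₁ t)

/-- The parameter of the algorithm. -/
noncomputable def algZ (t : ℕ) : Param cfg.m du dy := (algState P K ℓ cfg z₁ t).2.z

/-- The preconditioner at the start of each round. -/
noncomputable def algΛ (t : ℕ) :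
    Matrix (Fin cfg.m × Fin du × Fin dy) (Fin cfg.m × Fin du × Fin dy) ℝ :=
  (algState P K ℓ cfg z₁ t).2.Λ

lemma algState_succ_fst (t : ℕ) : (algState P K ℓ cfg z₁ (t + 1)).1 =
    P.A *ᵥ (algState P K ℓ cfg z₁ t).1 + P.B *ᵥ (K *ᵥ (P.C *ᵥ (algState P K ℓ cfg z₁ t).1 + P.e t) +
      algEx P K ℓ cfg z₁ t) + P.w t := rfl

lemma algIterate_eq (t : ℕ) : algIterate P K ℓ cfg z₁ t = natIterate P K t +
    WithLp.toLp 2 (∑ i ∈ Finset.range (t + 1), markovK P K i *ᵥ algEx P K ℓ cfg z₁ (t - i)) := by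
  rw [← driven_output_eq P K (fun t => (algState P K ℓ cfg z₁ t).1) (algEx P K ℓ cfg z₁) rfl
    (algState_succ_fst P K ℓ cfg z₁)]
  rfl

lemma algState_uex {s t : ℕ} (h : s < t) :
    (algState P K ℓ cfg z₁ t).2.uex s = algEx P K ℓ cfg z₁ s := by
  induction t with
  | zero => omega
  | succ t ih =>
    change Function.update (algState P K ℓ cfg z₁ t).2.uex t (algEx P K ℓ cfg z₁ t) s = _
    rcases Nat.lt_succ_iff_lt_or_eq.1 h with h | rfl
    · rw [Function.update_of_ne h.ne, ih h]
    · rw [Function.update_self]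

/-- The features therefore do not depend on the algorithm's own choices, and the recorded y^nat may
be replaced by y^K throughout. -/
lemma algState_recover {s t : ℕ} (h : s ≤ t) :
    (algState P K ℓ cfg z₁ t).2.recover (markovK P K) t (algY P K ℓ cfg z₁ t) s = natY P K s := by
  induction t with
  | zero =>
    obtain rfl : s = 0 := by omega
    rw [Memory.recover, Function.update_self]
    simp [algY, algState, natY, natX, ldcState]
  | succ t ih =>
    rw [Memory.recover]
    rcases Nat.le_succ_iff.1 h with h | rfl
    · rw [Function.update_of_ne (by omega)]
      exact ih h
    · rw [Function.update_self, Finset.sum_congr rfl fun i hi => by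
        rw [algState_uex P K ℓ cfg z₁ (Finset.mem_range.1 hi)]]
      exact driven_y_eq P K (fun t => (algState P K ℓ cfg z₁ t).1) (algEx P K ℓ cfg z₁) rfl
        (algState_succ_fst P K ℓ cfg z₁) _

lemma algEx_eq (t : ℕ) : algEx P K ℓ cfg z₁ t =
    embedY cfg.m du (natY P K) t *ᵥ (algZ P K ℓ cfg z₁ t).ofLp := by
  rw [algEx, Memory.exInput, embedY_congr fun s hs => algState_recover P K ℓ cfg z₁ hs, algZ]

lemma algΛ_succ (t : ℕ) : algΛ P K ℓ cfg z₁ (t + 1) = algΛ P K ℓ cfg z₁ t +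
    (featH cfg.h cfg.m (markovK P K) (natY P K) t)ᵀ *
      featH cfg.h cfg.m (markovK P K) (natY P K) t := by
  rw [← featH_congr fun s hs => algState_recover P K ℓ cfg z₁ hs]
  rfl

lemma algZ_succ (t : ℕ) : algZ P K ℓ cfg z₁ (t + 1) =
    semiOnsStep (drcSet cfg.m du dy cfg.R) cfg.η (algΛ P K ℓ cfg z₁ (t + 1))
      (fun z => ℓ t (natIterate P K t + WithLp.toLp 2
        (featH cfg.h cfg.m (markovK P K) (natY P K) t *ᵥ z.ofLp))) (algZ P K ℓ cfg z₁ t) := by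
  rw [← featH_congr fun s hs => algState_recover P K ℓ cfg z₁ hs, natIterate_eq,
    ← algState_recover P K ℓ cfg z₁ le_rfl]
  rfl

end Algorithm

/-! ### Weighted projections and semi-Newton steps -/

section Projection

variable {ι κ : Type*} [Fintype ι] [Fintype κ]

lemma quad_add {Λ : Matrix ι ι ℝ} (h : Λᵀ = Λ) (a d : ι → ℝ) (s : ℝ) :
    (a + s • d) ⬝ᵥ Λ *ᵥ (a + s • d) = a ⬝ᵥ Λ *ᵥ a + 2 * s * (d ⬝ᵥ Λ *ᵥ a) + s ^ 2 * (d ⬝ᵥ Λ *ᵥ d) := by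
  have hs : a ⬝ᵥ Λ *ᵥ d = d ⬝ᵥ Λ *ᵥ a := by
    rw [dotProduct_mulVec, ← mulVec_transpose, h, dotProduct_comm]
  simp only [mulVec_add, mulVec_smul, dotProduct_add, add_dotProduct, dotProduct_smul,
    smul_dotProduct, smul_eq_mul, hs]
  ring

lemma _root_.Matrix.PosDef.transpose_eq {ι : Type*} {Λ : Matrix ι ι ℝ} (h : Λ.PosDef) : Λᵀ = Λ := by
  simpa [conjTranspose_eq_transpose_of_trivial] using h.isHermitian.eq

lemma _root_.Matrix.PosDef.quad_nonneg {Λ : Matrix ι ι ℝ} (h : Λ.PosDef) (x : ι → ℝ) :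
    0 ≤ x ⬝ᵥ Λ *ᵥ x := by
  simpa using h.posSemidef.dotProduct_mulVec_nonneg x

lemma weightedProj_spec {S : Set (EuclideanSpace ℝ ι)} (hS : IsCompact S) (hne : S.Nonempty)
    (Λ : Matrix ι ι ℝ) (p : EuclideanSpace ℝ ι) :
    weightedProj S Λ p ∈ S ∧
      IsMinOn (fun q : EuclideanSpace ℝ ι => (q - p).ofLp ⬝ᵥ (Λ *ᵥ (q - p).ofLp)) S
        (weightedProj S Λ p) := by
  have hz : ∃ z ∈ S,
      IsMinOn (fun q : EuclideanSpace ℝ ι => (q - p).ofLp ⬝ᵥ (Λ *ᵥ (q - p).ofLp)) S z := by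
    refine hS.exists_isMinOn hne (Continuous.continuousOn ?_)
    simp only [dotProduct, mulVec]
    fun_prop
  rw [weightedProj, dif_pos hz]
  exact hz.choose_spec

lemma quad_weightedProj_sub_le {S : Set (EuclideanSpace ℝ ι)} (hS : IsCompact S)
    (hconv : Convex ℝ S) {Λ : Matrix ι ι ℝ} (hΛ : Λ.PosDef) (p : EuclideanSpace ℝ ι)
    {q : EuclideanSpace ℝ ι} (hq : q ∈ S) :
    (weightedProj S Λ p - q).ofLp ⬝ᵥ Λ *ᵥ (weightedProj S Λ p - q).ofLp ≤
      (p - q).ofLp ⬝ᵥ Λ *ᵥ (p - q).ofLp := by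
  obtain ⟨hmem, hmin⟩ := weightedProj_spec hS ⟨q, hq⟩ Λ p
  set z := weightedProj S Λ p
  have hT := hΛ.transpose_eq
  -- First-order optimality of the projection, from comparing z with points z + s(q - z).
  have key : 0 ≤ (q - z).ofLp ⬝ᵥ Λ *ᵥ (z - p).ofLp := by
    have hs : ∀ s : ℝ, 0 < s → s ≤ 1 →
        0 ≤ 2 * ((q - z).ofLp ⬝ᵥ Λ *ᵥ (z - p).ofLp) + s * ((q - z).ofLp ⬝ᵥ Λ *ᵥ (q - z).ofLp) := by
      intro s h0 h1
      have hm : z + s • (q - z) ∈ S := hconv.add_smul_sub_mem hmem hq ⟨h0.le, h1⟩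
      have h2 := isMinOn_iff.1 hmin _ hm
      have e : (z + s • (q - z) - p).ofLp = (z - p).ofLp + s • (q - z).ofLp := by
        funext i; simp; ring
      simp only [] at h2
      rw [e, quad_add hT] at h2
      have h3 : 0 ≤ s * (2 * ((q - z).ofLp ⬝ᵥ Λ *ᵥ (z - p).ofLp) +
          s * ((q - z).ofLp ⬝ᵥ Λ *ᵥ (q - z).ofLp)) := by linarith
      exact nonneg_of_mul_nonneg_right h3 h0
    by_contra hneg
    push Not at hneg
    set b := (q - z).ofLp ⬝ᵥ Λ *ᵥ (z - p).ofLp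
    set c := (q - z).ofLp ⬝ᵥ Λ *ᵥ (q - z).ofLp
    have hc : 0 ≤ c := hΛ.quad_nonneg _
    -- This s satisfies sc ≤ -b, so 2b + sc ≤ b < 0, a contradiction.
    have h1 := hs (min 1 (-b / (c + 1))) (lt_min one_pos (div_pos (neg_pos.2 hneg) (by linarith)))
      (min_le_left _ _)
    have h2 : min 1 (-b / (c + 1)) * c ≤ -b / (c + 1) * c :=
      mul_le_mul_of_nonneg_right (min_le_right _ _) hc
    have h3 : -b / (c + 1) * c ≤ -b := by
      rw [div_mul_eq_mul_div, div_le_iff₀ (by linarith)]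
      nlinarith
    linarith
  have e1 : (p - q).ofLp = (-1 : ℝ) • ((z - p).ofLp + (1 : ℝ) • (q - z).ofLp) := by
    funext i; simp
  have e2 : (z - q).ofLp = (-1 : ℝ) • (q - z).ofLp := by
    funext i; simp
  have hn : ∀ x : ι → ℝ, ((-1 : ℝ) • x) ⬝ᵥ Λ *ᵥ ((-1 : ℝ) • x) = x ⬝ᵥ Λ *ᵥ x := by
    intro x; simp [mulVec_neg]
  rw [e1, e2, hn, hn, quad_add hT]
  have := hΛ.quad_nonneg (z - p).ofLp
  linarith

variable [DecidableEq ι]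

lemma quad_newton_step {S : Set (EuclideanSpace ℝ ι)} (hS : IsCompact S) (hconv : Convex ℝ S)
    {Λ : Matrix ι ι ℝ} (hΛ : Λ.PosDef) (η : ℝ) (z : EuclideanSpace ℝ ι) (g : ι → ℝ)
    {q : EuclideanSpace ℝ ι} (hq : q ∈ S) :
    (weightedProj S Λ (z - η • WithLp.toLp 2 (Λ⁻¹ *ᵥ g)) - q).ofLp ⬝ᵥ Λ *ᵥ
        (weightedProj S Λ (z - η • WithLp.toLp 2 (Λ⁻¹ *ᵥ g)) - q).ofLp ≤
      (z - q).ofLp ⬝ᵥ Λ *ᵥ (z - q).ofLp - 2 * η * (g ⬝ᵥ (z - q).ofLp) +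
        η ^ 2 * (g ⬝ᵥ Λ⁻¹ *ᵥ g) := by
  refine (quad_weightedProj_sub_le hS hconv hΛ _ hq).trans (le_of_eq ?_)
  have e : (z - η • WithLp.toLp 2 (Λ⁻¹ *ᵥ g) - q).ofLp =
      (z - q).ofLp + (-η) • (Λ⁻¹ *ᵥ g) := by
    funext i; simp; ring
  have hT := hΛ.transpose_eq
  have hT' : (Λ⁻¹)ᵀ = Λ⁻¹ := by rw [transpose_nonsing_inv, hT]
  have hI : Λ⁻¹ * Λ = 1 := nonsing_inv_mul _ hΛ.det_pos.ne'.isUnit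
  have hI' : Λ * Λ⁻¹ = 1 := mul_nonsing_inv _ hΛ.det_pos.ne'.isUnit
  have h1 : (Λ⁻¹ *ᵥ g) ⬝ᵥ Λ *ᵥ (z - q).ofLp = g ⬝ᵥ (z - q).ofLp := by
    rw [← vecMul_transpose, hT', ← dotProduct_mulVec, mulVec_mulVec, hI, one_mulVec]
  have h2 : (Λ⁻¹ *ᵥ g) ⬝ᵥ Λ *ᵥ (Λ⁻¹ *ᵥ g) = g ⬝ᵥ Λ⁻¹ *ᵥ g := by
    rw [mulVec_mulVec, hI', one_mulVec, dotProduct_comm]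
  rw [e, quad_add hT, h1, h2]
  ring

end Projection

/-! ### Preconditioned online Newton iterates -/

section Newton

variable {ι κ : Type*} [Fintype ι] [Fintype κ] [DecidableEq ι]

/-- The data of projected semi-Newton iterates `z` on `S`, with features `H`, preconditioners `Λ`
and outer gradients `g` of norm at most `γ`. -/
structure NewtonIterates (S : Set (EuclideanSpace ℝ ι)) (α lam γ : ℝ) (H : ℕ → Matrix κ ι ℝ)
    (Λ : ℕ → Matrix ι ι ℝ) (g : ℕ → κ → ℝ) (z : ℕ → EuclideanSpace ℝ ι) : Prop where
  compact : IsCompact S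
  convex : Convex ℝ S
  α_pos : 0 < α
  lam_pos : 0 < lam
  Λ_zero : Λ 0 = lam • 1
  Λ_succ : ∀ t, Λ (t + 1) = Λ t + (H t)ᵀ * H t
  z_zero : z 0 ∈ S
  z_succ : ∀ t, z (t + 1) =
    weightedProj S (Λ (t + 1)) (z t - (1 / α) • WithLp.toLp 2 ((Λ (t + 1))⁻¹ *ᵥ ((H t)ᵀ *ᵥ g t)))
  grad_le : ∀ t, z t ∈ S → nrm (g t) ≤ γ

namespace NewtonIterates

variable {S : Set (EuclideanSpace ℝ ι)} {α lam γ : ℝ} {H : ℕ → Matrix κ ι ℝ}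
  {Λ : ℕ → Matrix ι ι ℝ} {g : ℕ → κ → ℝ} {z : ℕ → EuclideanSpace ℝ ι}

lemma posDef (N : NewtonIterates S α lam γ H Λ g z) (t : ℕ) : (Λ t).PosDef := by
  induction t with
  | zero => rw [N.Λ_zero]; exact PosDef.one.smul N.lam_pos
  | succ t ih => rw [N.Λ_succ]; exact posDef_add_transpose_mul_self ih _

lemma mem (N : NewtonIterates S α lam γ H Λ g z) (t : ℕ) : z t ∈ S := by
  cases t with
  | zero => exact N.z_zero
  | succ t => rw [N.z_succ]; exact (weightedProj_spec N.compact ⟨_, N.z_zero⟩ _ _).1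

lemma γ_nonneg (N : NewtonIterates S α lam γ H Λ g z) : 0 ≤ γ :=
  (nrm_nonneg _).trans (N.grad_le 0 N.z_zero)

lemma lev_nonneg (N : NewtonIterates S α lam γ H Λ g z) (t : ℕ) : 0 ≤ lev (Λ (t + 1)) (H t) :=
  DrcOns.lev_nonneg (N.posDef _) _

lemma quad_succ (N : NewtonIterates S α lam γ H Λ g z) (t : ℕ) (x : ι → ℝ) :
    x ⬝ᵥ Λ (t + 1) *ᵥ x = x ⬝ᵥ Λ t *ᵥ x + nrm (H t *ᵥ x) ^ 2 := by
  rw [N.Λ_succ, add_mulVec, dotProduct_add, nrm_sq, ← mulVec_mulVec, dotProduct_mulVec x (H t)ᵀ,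
    vecMul_transpose]

lemma quad_mono (N : NewtonIterates S α lam γ H Λ g z) {s t : ℕ} (h : s ≤ t) (x : ι → ℝ)
    : x ⬝ᵥ Λ s *ᵥ x ≤ x ⬝ᵥ Λ t *ᵥ x := by
  induction t, h using Nat.le_induction with
  | base => rfl
  | succ t _ ih => rw [N.quad_succ]; nlinarith [sq_nonneg (nrm (H t *ᵥ x))]

lemma grad_quad_le (N : NewtonIterates S α lam γ H Λ g z) (t : ℕ) : ((H t)ᵀ *ᵥ g t)
    ⬝ᵥ (Λ (t + 1))⁻¹ *ᵥ ((H t)ᵀ *ᵥ g t) ≤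
    γ ^ 2 * lev (Λ (t + 1)) (H t) := by
  refine (dotProduct_inv_mulVec_le_lev (N.posDef _) _ _).trans ?_
  rw [mul_comm]
  exact mul_le_mul_of_nonneg_right
    (pow_le_pow_left₀ (nrm_nonneg _) (N.grad_le t (N.mem t)) 2) (N.lev_nonneg t)

lemma regret_le (N : NewtonIterates S α lam γ H Λ g z) {q : EuclideanSpace ℝ ι} (hq : q ∈ S)
    (T : ℕ) :
    ∑ t ∈ Finset.range T, (g t ⬝ᵥ H t *ᵥ (z t - q).ofLp -
        α / 2 * nrm (H t *ᵥ (z t - q).ofLp) ^ 2) ≤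
      α / 2 * lam * ‖z 0 - q‖ ^ 2 +
        γ ^ 2 / (2 * α) * ∑ t ∈ Finset.range T, lev (Λ (t + 1)) (H t) := by
  have hα := N.α_pos
  -- The terminal potential is kept so that the induction telescopes; passing from Λ_T to Λ_{T+1}
  -- adds exactly the curvature term subtracted on the left.
  have main : ∑ t ∈ Finset.range T, (g t ⬝ᵥ H t *ᵥ (z t - q).ofLp -
        α / 2 * nrm (H t *ᵥ (z t - q).ofLp) ^ 2) ≤
      α / 2 * ((z 0 - q).ofLp ⬝ᵥ Λ 0 *ᵥ (z 0 - q).ofLp) -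
        α / 2 * ((z T - q).ofLp ⬝ᵥ Λ T *ᵥ (z T - q).ofLp) +
        γ ^ 2 / (2 * α) * ∑ t ∈ Finset.range T, lev (Λ (t + 1)) (H t) := by
    induction T with
    | zero => simp
    | succ T ih =>
      rw [Finset.sum_range_succ, Finset.sum_range_succ, mul_add]
      have h1 := quad_newton_step N.compact N.convex (N.posDef (T + 1)) (1 / α) (z T)
        ((H T)ᵀ *ᵥ g T) hq
      rw [← N.z_succ, N.quad_succ T (z T - q).ofLp, mulVec_transpose (H T), ← dotProduct_mulVec,
        ← mulVec_transpose] at h1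
      have h2 := mul_le_mul_of_nonneg_left (N.grad_quad_le T) (sq_nonneg (1 / α))
      have h3 := mul_le_mul_of_nonneg_left (h1.trans (add_le_add_right h2 _)) (half_pos hα).le
      have e : ∀ a b c l : ℝ, α / 2 * (a + b - 2 * (1 / α) * c + (1 / α) ^ 2 * (γ ^ 2 * l)) =
          α / 2 * a + α / 2 * b - c + γ ^ 2 / (2 * α) * l := by
        intro a b c l; field_simp
      rw [e] at h3
      linarith
  refine main.trans ?_
  have h0 : (z 0 - q).ofLp ⬝ᵥ Λ 0 *ᵥ (z 0 - q).ofLp = lam * ‖z 0 - q‖ ^ 2 := by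
    rw [N.Λ_zero, smul_mulVec, one_mulVec, dotProduct_smul, ← nrm_sq, nrm_ofLp, smul_eq_mul]
  have h1 := mul_nonneg (half_pos hα).le ((N.posDef T).quad_nonneg (z T - q).ofLp)
  rw [h0]
  linarith

/-- Taking q = z_t in `quad_newton_step` bounds the squared step in the Λ_{t+1}-norm by (γ/α)² times
the leverage at t. As Λ_{s+1} ≤ Λ_{t+1}, applying H_s costs the leverage at s; AM–GM then makes the
bound additive. -/
lemma movement_le (N : NewtonIterates S α lam γ H Λ g z) {s t : ℕ} (h : s ≤ t)
    : nrm (H s *ᵥ (z (t + 1) - z t).ofLp) ≤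
    γ / (2 * α) * (lev (Λ (s + 1)) (H s) + lev (Λ (t + 1)) (H t)) := by
  have hα := N.α_pos
  have hγ := N.γ_nonneg
  have h1 := quad_newton_step N.compact N.convex (N.posDef (t + 1)) (1 / α) (z t)
    ((H t)ᵀ *ᵥ g t) (N.mem t)
  rw [← N.z_succ, sub_self, WithLp.ofLp_zero, mulVec_zero, dotProduct_zero, dotProduct_zero] at h1
  have h2 := mul_le_mul_of_nonneg_left (N.grad_quad_le t) (sq_nonneg (1 / α))
  have h3 := nrm_mulVec_sq_le_lev (N.posDef (s + 1)) (H s) (z (t + 1) - z t).ofLp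
  have h4 := N.quad_mono (Nat.succ_le_succ h) (z (t + 1) - z t).ofLp
  have ls := N.lev_nonneg s
  have lt := N.lev_nonneg t
  have h5 := h3.trans (mul_le_mul_of_nonneg_left (show _ ≤ (γ / α) ^ 2 * lev (Λ (t + 1)) (H t) by
    have : (1 / α) ^ 2 * (γ ^ 2 * lev (Λ (t + 1)) (H t)) = (γ / α) ^ 2 * lev (Λ (t + 1)) (H t) := by
      ring
    linarith) ls)
  refine abs_le_of_sq_le_sq' (h5.trans ?_) (by positivity) |>.2
  generalize lev (Λ (s + 1)) (H s) = a at *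
  generalize lev (Λ (t + 1)) (H t) = b at *
  have e : (γ / (2 * α) * (a + b)) ^ 2 = (γ / α) ^ 2 * ((a + b) ^ 2 / 4) := by ring
  rw [e]
  have : a * b ≤ (a + b) ^ 2 / 4 := by nlinarith [sq_nonneg (a - b)]
  nlinarith [mul_le_mul_of_nonneg_left this (sq_nonneg (γ / α))]

lemma drift_le (N : NewtonIterates S α lam γ H Λ g z) (s i : ℕ) : nrm (H s *ᵥ (z (s + i)
    - z s).ofLp) ≤
    γ / (2 * α) * ∑ k ∈ Finset.range i,
      (lev (Λ (s + 1)) (H s) + lev (Λ (s + k + 1)) (H (s + k))) := by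
  induction i with
  | zero => simp
  | succ i ih =>
    have e : (z (s + (i + 1)) - z s).ofLp =
        (z (s + i) - z s).ofLp + (z (s + i + 1) - z (s + i)).ofLp := by
      rw [← WithLp.ofLp_add]; congr 1; rw [← add_assoc]; abel
    rw [Finset.sum_range_succ, mul_add, e, mulVec_add]
    exact (nrm_add_le _ _).trans (add_le_add ih (N.movement_le (Nat.le_add_right s i)))

/-- The log-determinants telescope, and `htr` keeps the trace of Λ_T below that of λ(1 + T)I, so λ
cancels from the final ratio. -/
lemma sum_lev_le (N : NewtonIterates S α lam γ H Λ g z)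
    (htr : ∀ t, ((H t)ᵀ * H t).trace ≤ lam * Fintype.card ι) (T : ℕ) :
    ∑ t ∈ Finset.range T, lev (Λ (t + 1)) (H t) ≤ Fintype.card ι * Real.log (1 + T) := by
  have h1 : ∑ t ∈ Finset.range T, lev (Λ (t + 1)) (H t) ≤
      Real.log (Λ T).det - Real.log (Λ 0).det := by
    rw [← Finset.sum_range_sub fun t => Real.log (Λ t).det]
    refine Finset.sum_le_sum fun t _ => ?_
    rw [N.Λ_succ]
    exact lev_le_log_det_sub (N.posDef t) _
  have h2 : ∀ t : ℕ, (Λ t).trace ≤ lam * (1 + t) * Fintype.card ι := by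
    intro t
    induction t with
    | zero => simp [N.Λ_zero, trace_smul]
    | succ t ih =>
      rw [N.Λ_succ, trace_add]
      push_cast
      linarith [htr t]
  have hlam := N.lam_pos
  have h3 := log_det_le (N.posDef T) (by positivity) (h2 T)
  rw [Real.log_mul hlam.ne' (by positivity)] at h3
  have h4 : Real.log (Λ 0).det = Fintype.card ι * Real.log lam := by
    rw [N.Λ_zero, det_smul, det_one, mul_one, Real.log_pow]
  linarith

end NewtonIterates

/-- After exchanging the sums, lag i contributes 2i shifted copies of the sum of l, each at most the
full sum because every index stays below T. -/
lemma sum_delayed_le {l w : ℕ → ℝ} (hl : ∀ t, 0 ≤ l t) (hw : ∀ t, 0 ≤ w t) (n T : ℕ) :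
    ∑ t ∈ Finset.range T, ∑ i ∈ Finset.range n,
      (if i ≤ t then w i * ∑ k ∈ Finset.range i, (l (t - i) + l (t - i + k)) else 0) ≤
      (∑ i ∈ Finset.range n, i * w i) * (2 * ∑ t ∈ Finset.range T, l t) := by
  rw [Finset.sum_comm, Finset.sum_mul]
  refine Finset.sum_le_sum fun i _ => ?_
  have hshift : ∀ k < i + 1, ∑ r ∈ Finset.range (T - i), l (r + k) ≤ ∑ t ∈ Finset.range T, l t := by
    intro k hk
    rw [Finset.range_eq_Ico, Finset.sum_Ico_add']
    by_cases hT : i ≤ T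
    · exact Finset.sum_le_sum_of_subset_of_nonneg
        (fun x hx => by simp only [Finset.mem_Ico, Finset.mem_range] at *; omega)
        fun _ _ _ => hl _
    · rw [Nat.sub_eq_zero_of_le (by omega)]
      simpa using Finset.sum_nonneg fun t _ => hl t
  calc _ = ∑ t ∈ Finset.Ico i T, w i * ∑ k ∈ Finset.range i, (l (t - i) + l (t - i + k)) := by
        rw [← Finset.sum_filter]
        refine Finset.sum_congr ?_ fun _ _ => rfl
        ext t; simp [and_comm]
    _ = w i * ∑ k ∈ Finset.range i, (∑ r ∈ Finset.range (T - i), l (r + 0) +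
          ∑ r ∈ Finset.range (T - i), l (r + k)) := by
        rw [Finset.sum_Ico_eq_sum_range, ← Finset.mul_sum, Finset.sum_comm]
        simp [Finset.sum_add_distrib]
    _ ≤ w i * ∑ k ∈ Finset.range i, (2 * ∑ t ∈ Finset.range T, l t) := by
        refine mul_le_mul_of_nonneg_left (Finset.sum_le_sum fun k hk => ?_) (hw i)
        have h1 := hshift 0 (Nat.succ_pos _)
        have h2 := hshift k (by have := Finset.mem_range.1 hk; omega)
        linarith
    _ = _ := by
        rw [Finset.sum_const, Finset.card_range, nsmul_eq_mul]; ring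

end Newton

/-! ### Geometric sums -/

section Geometric

lemma sum_pow_le {ρ : ℝ} (h0 : 0 < ρ) (h1 : ρ < 1) (n : ℕ) :
    ∑ i ∈ Finset.range n, ρ ^ i ≤ 1 / (1 - ρ) := by
  rw [one_div, ← tsum_geometric_of_lt_one h0.le h1]
  exact (summable_geometric_of_lt_one h0.le h1).sum_le_tsum _ fun i _ => pow_nonneg h0.le i

lemma sum_natCast_mul_pow_le {ρ : ℝ} (h0 : 0 < ρ) (h1 : ρ < 1) (n : ℕ) :
    ∑ i ∈ Finset.range n, (i : ℝ) * ρ ^ i ≤ 1 / (1 - ρ) ^ 2 := by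
  have hρ : ‖ρ‖ < 1 := by rwa [Real.norm_of_nonneg h0.le]
  have h := sum_le_hasSum (Finset.range n) (fun i _ => by positivity)
    (hasSum_coe_mul_geometric_of_norm_lt_one hρ)
  refine h.trans ?_
  have : 0 < 1 - ρ := by linarith
  gcongr

lemma sum_pow_tail_le {ρ : ℝ} (h0 : 0 < ρ) (h1 : ρ < 1) (h n : ℕ) :
    ∑ i ∈ Finset.range n, (if i < h then 0 else ρ ^ i) ≤ ρ ^ h / (1 - ρ) := by
  have h2 : ∑ i ∈ Finset.range n, (if i < h then 0 else ρ ^ i) ≤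
      ∑ i ∈ Finset.range n, ρ ^ h * ρ ^ i := by
    induction n with
    | zero => simp
    | succ n ih =>
      by_cases hn : n < h
      · rw [Finset.sum_range_succ, Finset.sum_range_succ, if_pos hn]
        exact add_le_add ih (by positivity)
      · have e : n + 1 = h + (n - h + 1) := by omega
        have hz : ∑ i ∈ Finset.range h, (if i < h then (0 : ℝ) else ρ ^ i) = 0 :=
          Finset.sum_eq_zero fun i hi => if_pos (Finset.mem_range.1 hi)
        rw [e, Finset.sum_range_add, hz, zero_add]
        refine (Finset.sum_le_sum_of_subset_of_nonneg (Finset.range_mono (by omega))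
          fun _ _ _ => by positivity).trans' (Finset.sum_le_sum fun i _ => ?_)
        rw [if_neg (by omega), pow_add]
  refine h2.trans ?_
  rw [← Finset.mul_sum, div_eq_mul_one_div]
  exact mul_le_mul_of_nonneg_left (sum_pow_le h0 h1 n) (by positivity)

lemma sum_range_ite_swap {M : Type*} [AddCommMonoid M] (f : ℕ → M) (a b : ℕ) :
    ∑ i ∈ Finset.range a, (if i < b then f i else 0) =
      ∑ i ∈ Finset.range b, (if i < a then f i else 0) := by
  rw [← Finset.sum_filter, ← Finset.sum_filter]
  refine Finset.sum_congr ?_ fun _ _ => rfl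
  ext i; simp [and_comm]

end Geometric

/-! ### Disturbance-response parameters -/

section Response

variable {dx du dy m : ℕ} {R r : ℝ}

/-- Entries are bounded by the operator norm, and a sum of squares by the square of the sum; hence
no factor m. -/
lemma drcSet_norm_sq_le {z : Param m du dy} (hz : z ∈ drcSet m du dy R) :
    ‖z‖ ^ 2 ≤ du * dy * R ^ 2 := by
  have hz : ∑ i : Fin m, opNorm (z.mat i) ≤ R := hz
  have h1 : ∀ i : Fin m, ∑ p : Fin du × Fin dy, z (i, p) ^ 2 ≤ du * dy * opNorm (z.mat i) ^ 2 := by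
    intro i
    refine (Finset.sum_le_card_nsmul _ _ (opNorm (z.mat i) ^ 2) fun p _ => ?_).trans (by simp)
    rw [← sq_abs]
    exact pow_le_pow_left₀ (abs_nonneg _) (abs_entry_le_opNorm (z.mat i) p.1 p.2) 2
  have h2 : ∑ i : Fin m, opNorm (z.mat i) ^ 2 ≤ (∑ i : Fin m, opNorm (z.mat i)) ^ 2 :=
    Finset.sum_sq_le_sq_sum_of_nonneg fun i _ => opNorm_nonneg _
  have h3 : (∑ i : Fin m, opNorm (z.mat i)) ^ 2 ≤ R ^ 2 :=
    pow_le_pow_left₀ (Finset.sum_nonneg fun i _ => opNorm_nonneg _) hz 2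
  rw [EuclideanSpace.norm_sq_eq, Fintype.sum_prod_type]
  simp only [Real.norm_eq_abs, sq_abs]
  calc _ ≤ ∑ i : Fin m, du * dy * opNorm (z.mat i) ^ 2 := Finset.sum_le_sum fun i _ => h1 i
    _ = du * dy * ∑ i : Fin m, opNorm (z.mat i) ^ 2 := by rw [Finset.mul_sum]
    _ ≤ _ := mul_le_mul_of_nonneg_left (h2.trans h3) (by positivity)

lemma isCompact_drcSet (m du dy : ℕ) (R : ℝ) : IsCompact (drcSet m du dy R) := by
  refine Metric.isCompact_of_isClosed_isBounded ?_ ?_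
  · refine isClosed_le (continuous_finsetSum _ fun i _ => continuous_opNorm.comp ?_)
      continuous_const
    refine continuous_matrix fun a b => ?_
    simp only [Param.mat, of_apply]
    fun_prop
  · refine (Metric.isBounded_closedBall (x := 0) (r := Real.sqrt (du * dy * R ^ 2))).subset ?_
    intro z hz
    rw [mem_closedBall_zero_iff]
    exact Real.le_sqrt_of_sq_le (drcSet_norm_sq_le hz)

lemma convex_drcSet (m du dy : ℕ) (R : ℝ) : Convex ℝ (drcSet m du dy R) := by
  intro z hz w hw a b ha hb hab
  have hz : ∑ i : Fin m, opNorm (z.mat i) ≤ R := hz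
  have hw : ∑ i : Fin m, opNorm (w.mat i) ≤ R := hw
  have h : ∀ i, opNorm (Param.mat (a • z + b • w) i) ≤
      a * opNorm (z.mat i) + b * opNorm (w.mat i) := by
    intro i
    have e : Param.mat (a • z + b • w) i = a • z.mat i + b • w.mat i := rfl
    rw [e]
    refine (opNorm_add_le _ _).trans ?_
    rw [opNorm_smul, opNorm_smul, abs_of_nonneg ha, abs_of_nonneg hb]
  change ∑ i : Fin m, opNorm (Param.mat (a • z + b • w) i) ≤ R
  calc _ ≤ ∑ i : Fin m, (a * opNorm (z.mat i) + b * opNorm (w.mat i)) :=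
        Finset.sum_le_sum fun i _ => h i
    _ = a * ∑ i : Fin m, opNorm (z.mat i) + b * ∑ i : Fin m, opNorm (w.mat i) := by
        rw [Finset.sum_add_distrib, Finset.mul_sum, Finset.mul_sum]
    _ ≤ a * R + b * R := by gcongr
    _ = R := by rw [← add_mul, hab, one_mul]

variable {ω : ℕ → Vec dy}

lemma nrm_embedY_mulVec_le (hr : 0 ≤ r) (hω : ∀ s, nrm (ω s) ≤ r) {z : Param m du dy}
    (hz : z ∈ drcSet m du dy R) (t : ℕ) : nrm (embedY m du ω t *ᵥ z.ofLp) ≤ R * r := by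
  have hz : ∑ i : Fin m, opNorm (z.mat i) ≤ R := hz
  rw [embedY_mulVec]
  refine (nrm_sum_le _ _).trans ((Finset.sum_le_sum (g := fun i => opNorm (z.mat i) * r)
    fun i _ => ?_).trans ?_)
  · split_ifs
    · exact (nrm_mulVec_le _ _).trans (mul_le_mul_of_nonneg_left (hω _) (opNorm_nonneg _))
    · rw [nrm_zero]; exact mul_nonneg (opNorm_nonneg _) hr
  · rw [← Finset.sum_mul]
    exact mul_le_mul_of_nonneg_right hz hr

lemma nrm_embedY_single_le (hr : 0 ≤ r) (hω : ∀ s, nrm (ω s) ≤ r) (t : ℕ)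
    (j : Fin m × Fin du × Fin dy) : nrm (embedY m du ω t *ᵥ Pi.single j 1) ≤ r := by
  rw [mulVec_single_one]
  by_cases h : (j.1 : ℕ) ≤ t
  · have e : (embedY m du ω t).col j = Pi.single j.2.1 (ω (t - j.1) j.2.2) := by
      funext a
      simp [embedY, h, Pi.single_apply]
    rw [e, nrm_single]
    exact (abs_le_nrm _ _).trans (hω _)
  · have e : (embedY m du ω t).col j = 0 := by
      funext a
      simp [embedY, h]
    rw [e, nrm_zero]
    exact hr

variable {h : ℕ} {G : ℕ → Matrix (Fin dy ⊕ Fin du) (Fin du) ℝ} {c ρ : ℝ}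

lemma featH_mulVec (t : ℕ) (x : Fin m × Fin du × Fin dy → ℝ) : featH h m G ω t *ᵥ x =
    ∑ i ∈ Finset.range (t + 1), if i < h + 1 then G i *ᵥ embedY m du ω (t - i) *ᵥ x else 0 := by
  rw [← sum_range_ite_swap, featH, sum_mulVec]
  refine Finset.sum_congr rfl fun i _ => ?_
  simp only [Nat.lt_succ_iff]
  split_ifs
  · rw [mulVec_mulVec]
  · rw [zero_mulVec]

lemma nrm_markov_sum_le (hc : 0 < c) (hρ0 : 0 < ρ) (hρ1 : ρ < 1)
    (hG : ∀ n, opNorm (G n) ≤ c * ρ ^ n) {u : ℕ → Vec du} (hr : 0 ≤ r) {n : ℕ}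
    (hu : ∀ i < n, nrm (u i) ≤ r) :
    nrm (∑ i ∈ Finset.range n, G i *ᵥ u i) ≤ c / (1 - ρ) * r := by
  refine (nrm_sum_le _ _).trans ((Finset.sum_le_sum (g := fun i => c * r * ρ ^ i)
    fun i hi => ?_).trans ?_)
  · refine (nrm_mulVec_le _ _).trans ?_
    calc _ ≤ (c * ρ ^ i) * r :=
          mul_le_mul (hG i) (hu i (Finset.mem_range.1 hi)) (nrm_nonneg _) (by positivity)
      _ = _ := by ring
  · rw [← Finset.mul_sum]
    calc _ ≤ c * r * (1 / (1 - ρ)) :=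
          mul_le_mul_of_nonneg_left (sum_pow_le hρ0 hρ1 n) (by positivity)
      _ = _ := by ring

lemma nrm_featH_mulVec_le (hc : 0 < c) (hρ0 : 0 < ρ) (hρ1 : ρ < 1)
    (hG : ∀ n, opNorm (G n) ≤ c * ρ ^ n) (hr : 0 ≤ r) {x : Fin m × Fin du × Fin dy → ℝ}
    (hx : ∀ s, nrm (embedY m du ω s *ᵥ x) ≤ r) (t : ℕ) :
    nrm (featH h m G ω t *ᵥ x) ≤ c / (1 - ρ) * r := by
  have e : featH h m G ω t *ᵥ x = ∑ i ∈ Finset.range (t + 1),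
      G i *ᵥ (if i < h + 1 then embedY m du ω (t - i) *ᵥ x else 0) := by
    rw [featH_mulVec]
    refine Finset.sum_congr rfl fun i _ => ?_
    split_ifs <;> simp
  rw [e]
  refine nrm_markov_sum_le hc hρ0 hρ1 hG hr fun i _ => ?_
  split_ifs
  · exact hx _
  · simpa using hr

lemma trace_featH_le (hc : 0 < c) (hρ0 : 0 < ρ) (hρ1 : ρ < 1)
    (hG : ∀ n, opNorm (G n) ≤ c * ρ ^ n) (hr : 0 ≤ r) (hω : ∀ s, nrm (ω s) ≤ r) (t : ℕ) :
    ((featH h m G ω t)ᵀ * featH h m G ω t).trace ≤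
      (c / (1 - ρ) * r) ^ 2 * Fintype.card (Fin m × Fin du × Fin dy) := by
  have e : ∀ j, ((featH h m G ω t)ᵀ * featH h m G ω t) j j =
      nrm (featH h m G ω t *ᵥ Pi.single j 1) ^ 2 := by
    intro j
    rw [nrm_sq, mulVec_single_one, mul_apply]
    rfl
  simp only [trace, diag, e]
  refine (Finset.sum_le_card_nsmul _ _ ((c / (1 - ρ) * r) ^ 2) fun j _ => ?_).trans
    (by rw [nsmul_eq_mul, mul_comm, Finset.card_univ])
  exact pow_le_pow_left₀ (nrm_nonneg _) (nrm_featH_mulVec_le hc hρ0 hρ1 hG hr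
    (fun s => nrm_embedY_single_le hr hω s j) t) 2

/-- The matrix recovering the exogenous input `u - K y` from `(y, u)`. -/
noncomputable def exMat (K : Matrix (Fin du) (Fin dy) ℝ) : Matrix (Fin du) (Fin dy ⊕ Fin du) ℝ :=
  fromCols (-K) 1

lemma exMat_mul_markovK (P : Plant dx du dy) (K : Matrix (Fin du) (Fin dy) ℝ) (i : ℕ) :
    exMat K * markovK P K i = if i = 0 then 1 else 0 := by
  rcases i with _ | i
  · rw [markovK, exMat, fromCols_mul_fromRows]
    simp
  · rw [markovK, exMat, ← Matrix.mul_assoc, ← Matrix.mul_assoc, fromCols_mul_fromRows]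
    simp

/-- [-K I] annihilates G_K at every positive lag and is a left inverse at lag 0, so only the current
Y_t survives. -/
lemma exMat_mulVec_featH (P : Plant dx du dy) (K : Matrix (Fin du) (Fin dy) ℝ) (t : ℕ)
    (x : Fin m × Fin du × Fin dy → ℝ) :
    exMat K *ᵥ featH h m (markovK P K) ω t *ᵥ x = embedY m du ω t *ᵥ x := by
  rw [featH_mulVec, mulVec_sum, Finset.sum_range_succ', Finset.sum_eq_zero, zero_add,
    if_pos (Nat.succ_pos h), mulVec_mulVec, exMat_mul_markovK, if_pos rfl, one_mulVec, Nat.sub_zero]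
  intro i _
  split_ifs
  · rw [mulVec_mulVec, exMat_mul_markovK, if_neg (Nat.succ_ne_zero i), zero_mulVec]
  · rw [mulVec_zero]

lemma nrm_exMat_mulVec_le (K : Matrix (Fin du) (Fin dy) ℝ) (v : Fin dy ⊕ Fin du → ℝ) :
    nrm (exMat K *ᵥ v) ≤ (1 + opNorm K) * nrm v := by
  obtain ⟨y, u, rfl⟩ : ∃ y u, v = Sum.elim y u := ⟨v ∘ Sum.inl, v ∘ Sum.inr, by simp⟩
  have h := nrm_sumElim y u
  have hy : nrm y ≤ nrm (Sum.elim y u) :=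
    abs_le_of_sq_le_sq' (by nlinarith [sq_nonneg (nrm u)]) (nrm_nonneg _) |>.2
  have hu : nrm u ≤ nrm (Sum.elim y u) :=
    abs_le_of_sq_le_sq' (by nlinarith [sq_nonneg (nrm y)]) (nrm_nonneg _) |>.2
  rw [exMat, fromCols_mulVec_sumElim, neg_mulVec, one_mulVec]
  refine (nrm_add_le _ _).trans ?_
  rw [nrm_neg, add_mul, one_mul, add_comm]
  exact add_le_add hu ((nrm_mulVec_le _ _).trans (mul_le_mul_of_nonneg_left hy (opNorm_nonneg _)))

lemma nrm_embedY_le_featH (P : Plant dx du dy) (K : Matrix (Fin du) (Fin dy) ℝ) (h : ℕ) (t : ℕ)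
    (x : Fin m × Fin du × Fin dy → ℝ) : nrm (embedY m du ω t *ᵥ x) ≤
      (1 + opNorm K) * nrm (featH h m (markovK P K) ω t *ᵥ x) := by
  rw [← exMat_mulVec_featH (h := h) P K]
  exact nrm_exMat_mulVec_le K _

end Response

/-! ### Natural outputs and gradients of affine compositions -/

section Pair

variable {dx du dy : ℕ}

lemma nrm_natY_le (P : Plant dx du dy) (K : Matrix (Fin du) (Fin dy) ℝ) (t : ℕ) :
    nrm (natY P K t) ≤ ‖natIterate P K t‖ := by
  rw [natIterate_eq, pair]
  have h := nrm_sumElim (natY P K t) (K *ᵥ natY P K t)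
  exact abs_le_of_sq_le_sq' (by rw [nrm] at h; nlinarith [sq_nonneg (nrm (K *ᵥ natY P K t))])
    (norm_nonneg _) |>.2

lemma gradient_comp_affine {ι κ : Type*} [Fintype ι] [Fintype κ]
    {f : EuclideanSpace ℝ κ → ℝ} (hf : Differentiable ℝ f) (v : EuclideanSpace ℝ κ)
    (H : Matrix κ ι ℝ) (z : EuclideanSpace ℝ ι) :
    gradient (fun z : EuclideanSpace ℝ ι => f (v + WithLp.toLp 2 (H *ᵥ z.ofLp))) z =
      WithLp.toLp 2 (Hᵀ *ᵥ (gradient f (v + WithLp.toLp 2 (H *ᵥ z.ofLp))).ofLp) := by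
  classical
  refine HasGradientAt.gradient ?_
  rw [hasGradientAt_iff_hasFDerivAt]
  have h1 : HasFDerivAt (fun z : EuclideanSpace ℝ ι => v + WithLp.toLp 2 (H *ᵥ z.ofLp))
      (LinearMap.toContinuousLinearMap (Matrix.toEuclideanLin H)) z :=
    (LinearMap.toContinuousLinearMap (Matrix.toEuclideanLin H)).hasFDerivAt.const_add v
  have h2 := (hf (v + WithLp.toLp 2 (H *ᵥ z.ofLp))).hasGradientAt.hasFDerivAt.comp z h1
  refine h2.congr_fderiv ?_
  ext x
  simp only [InnerProductSpace.toDual_apply_apply, ContinuousLinearMap.comp_apply,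
    inner_eq_dotProduct]
  rw [mulVec_transpose, ← dotProduct_mulVec]
  rfl

end Pair

/-! ### Regret of the algorithm -/

section Regret

variable {dx du dy : ℕ} {P : Plant dx du dy} {K : Matrix (Fin du) (Fin dy) ℝ}
  {ℓ : ℕ → Sig dy du → ℝ} {L α Rnat cK ρK : ℝ}

/-- The iterate `v_t^nat + H_t z` with respect to which the surrogate losses of the algorithm are
defined. -/
noncomputable def surrogate (P : Plant dx du dy) (K : Matrix (Fin du) (Fin dy) ℝ) (h m t : ℕ)
    (z : Param m du dy) : Sig dy du :=
  natIterate P K t + WithLp.toLp 2 (featH h m (markovK P K) (natY P K) t *ᵥ z.ofLp)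

/-- The iterates under `u = K y` are bounded and the nominal Markov operator decays geometrically. -/
structure StableNominal (P : Plant dx du dy) (K : Matrix (Fin du) (Fin dy) ℝ)
    (Rnat cK ρK : ℝ) : Prop where
  one_le_Rnat : 1 ≤ Rnat
  nat_le : ∀ t, ‖natIterate P K t‖ ≤ Rnat
  cK_pos : 0 < cK
  ρK_pos : 0 < ρK
  ρK_lt_one : ρK < 1
  markov_le : ∀ n : ℕ, opNorm (markovK P K n) ≤ cK * ρK ^ n

namespace StableNominal

lemma nrm_natY_le (A : StableNominal P K Rnat cK ρK) (t : ℕ) : nrm (natY P K t) ≤ Rnat :=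
  (DrcOns.nrm_natY_le P K t).trans (A.nat_le t)

lemma Rnat_nonneg (A : StableNominal P K Rnat cK ρK) : 0 ≤ Rnat := zero_le_one.trans A.one_le_Rnat

lemma norm_surrogate_le (A : StableNominal P K Rnat cK ρK) {R : ℝ} (hR : 0 ≤ R)
    {h m : ℕ} {z : Param m du dy}
    (hz : z ∈ drcSet m du dy R) (t : ℕ) :
    ‖surrogate P K h m t z‖ ≤ Rnat + cK / (1 - ρK) * (R * Rnat) :=
  (norm_add_le _ _).trans (add_le_add (A.nat_le t)
    (nrm_featH_mulVec_le A.cK_pos A.ρK_pos A.ρK_lt_one A.markov_le (mul_nonneg hR A.Rnat_nonneg)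
      (nrm_embedY_mulVec_le A.Rnat_nonneg A.nrm_natY_le hz) t))

/-- Comparison of a trajectory driven by exogenous inputs with a surrogate iterate, given bounds
on the inputs and on their distance to the inputs of the surrogate. -/
lemma norm_driven_sub_surrogate_le (A : StableNominal P K Rnat cK ρK) {r : ℝ} (hr : 0 ≤ r)
    {h m t : ℕ} (z : Param m du dy)
    {u : ℕ → Vec du} {ε : ℕ → ℝ} (hu : ∀ s, nrm (u s) ≤ r)
    (hε : ∀ i ≤ t, i < h + 1 →
      nrm (u (t - i) - embedY m du (natY P K) (t - i) *ᵥ z.ofLp) ≤ ε i) :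
    ‖natIterate P K t +
        WithLp.toLp 2 (∑ i ∈ Finset.range (t + 1), markovK P K i *ᵥ u (t - i)) -
        surrogate P K h m t z‖ ≤
      ∑ i ∈ Finset.range (h + 1), (if i ≤ t then cK * ρK ^ i * ε i else 0) +
        cK / (1 - ρK) * r * ρK ^ h := by
  have hc := A.cK_pos
  have h0 := A.ρK_pos
  have h1 : 0 < 1 - ρK := sub_pos.2 A.ρK_lt_one
  have e : natIterate P K t +
        WithLp.toLp 2 (∑ i ∈ Finset.range (t + 1), markovK P K i *ᵥ u (t - i)) -
        surrogate P K h m t z = WithLp.toLp 2 (∑ i ∈ Finset.range (t + 1), (markovK P K i *ᵥ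
          if i < h + 1 then u (t - i) - embedY m du (natY P K) (t - i) *ᵥ z.ofLp
          else u (t - i))) := by
    rw [surrogate, add_sub_add_left_eq_sub, ← WithLp.toLp_sub, featH_mulVec,
      ← Finset.sum_sub_distrib]
    congr 1
    refine Finset.sum_congr rfl fun i _ => ?_
    split_ifs
    · rw [mulVec_sub]
    · rw [sub_zero]
  rw [e]
  refine (nrm_sum_le _ _).trans ((Finset.sum_le_sum (g := fun i =>
    (if i < h + 1 then cK * ρK ^ i * ε i else 0) +
      cK * r * (if i < h + 1 then 0 else ρK ^ i)) fun i hi => ?_).trans ?_)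
  · have hm : ∀ x : Vec du, nrm (markovK P K i *ᵥ x) ≤ cK * ρK ^ i * nrm x := fun x =>
      (nrm_mulVec_le _ _).trans (mul_le_mul_of_nonneg_right (A.markov_le i) (nrm_nonneg _))
    split_ifs with hih
    · rw [mul_zero, add_zero]
      exact (hm _).trans (mul_le_mul_of_nonneg_left
        (hε i (Nat.lt_succ_iff.1 (Finset.mem_range.1 hi)) hih) (by positivity))
    · rw [zero_add]
      refine (hm _).trans ((mul_le_mul_of_nonneg_left (hu _) (by positivity)).trans (le_of_eq ?_))
      ring
  · rw [Finset.sum_add_distrib, ← Finset.mul_sum]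
    refine add_le_add (le_of_eq ?_) ?_
    · rw [sum_range_ite_swap]
      simp only [Nat.lt_succ_iff]
    · calc _ ≤ cK * r * (ρK ^ (h + 1) / (1 - ρK)) :=
            mul_le_mul_of_nonneg_left (sum_pow_tail_le h0 A.ρK_lt_one _ _) (by positivity)
        _ ≤ cK * r * (ρK ^ h / (1 - ρK)) := by
            have := pow_le_pow_of_le_one h0.le A.ρK_lt_one.le (Nat.le_succ h)
            gcongr
        _ = _ := by ring

variable {cfg : Config} {z₁ : Param cfg.m du dy}

lemma newtonIterates (A : StableNominal P K Rnat cK ρK) (hℓ : ∀ t, LossRegular L α (ℓ t))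
    (hα : 0 < α) (hR : 0 ≤ cfg.R)
    (hη : cfg.η = 1 / α) (hlam : 0 < cfg.lam) (hz₁ : z₁ ∈ drcSet cfg.m du dy cfg.R) {r : ℝ}
    (hr1 : 1 ≤ r) (hr : Rnat + cK / (1 - ρK) * (cfg.R * Rnat) ≤ r) :
    NewtonIterates (drcSet cfg.m du dy cfg.R) α cfg.lam (L * r)
      (featH cfg.h cfg.m (markovK P K) (natY P K)) (algΛ P K ℓ cfg z₁)
      (fun t => (gradient (ℓ t) (surrogate P K cfg.h cfg.m t (algZ P K ℓ cfg z₁ t))).ofLp)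
      (algZ P K ℓ cfg z₁) where
  compact := isCompact_drcSet _ _ _ _
  convex := convex_drcSet _ _ _ _
  α_pos := hα
  lam_pos := hlam
  Λ_zero := rfl
  Λ_succ := algΛ_succ P K ℓ cfg z₁
  z_zero := hz₁
  z_succ t := by
    rw [algZ_succ, semiOnsStep, gradient_comp_affine (hℓ t).differentiable, hη]
    rfl
  grad_le t ht := ((hℓ t).gradient_le _).trans (mul_le_mul_of_nonneg_left
    (max_le hr1 ((A.norm_surrogate_le hR ht t).trans hr)) (hℓ t).nonneg_const)

/-- Regret of the algorithm against a fixed parameter of the surrogate losses. -/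
lemma sum_loss_alg_sub_le (A : StableNominal P K Rnat cK ρK) (hℓ : ∀ t, LossRegular L α (ℓ t))
    (hα : 0 < α) (hR : 0 ≤ cfg.R)
    (hη : cfg.η = 1 / α) (hlam : 0 < cfg.lam) (hlam' : (cK / (1 - ρK) * Rnat) ^ 2 ≤ cfg.lam)
    (hz₁ : z₁ ∈ drcSet cfg.m du dy cfg.R) {r : ℝ}
    (hr1 : 1 ≤ r) (hr : Rnat + cK / (1 - ρK) * (cfg.R * Rnat) ≤ r)
    {q : Param cfg.m du dy} (hq : q ∈ drcSet cfg.m du dy cfg.R) (T : ℕ) :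
    ∑ t ∈ Finset.range T, ℓ t (algIterate P K ℓ cfg z₁ t) -
        ∑ t ∈ Finset.range T, ℓ t (surrogate P K cfg.h cfg.m t q) ≤
      L * r * (T * (cK / (1 - ρK) * (cfg.R * Rnat) * ρK ^ cfg.h)) +
      2 * α * cfg.lam * (du * dy * cfg.R ^ 2) +
      (L * r) ^ 2 / α * (1 / 2 + (1 + opNorm K) * cK / (1 - ρK) ^ 2) *
        (cfg.m * (du * dy) * Real.log (1 + T)) := by
  have N := A.newtonIterates hℓ hα hR hη hlam hz₁ hr1 hr
  set z := algZ P K ℓ cfg z₁ with hz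
  set Λ := algΛ P K ℓ cfg z₁
  set H := featH cfg.h cfg.m (markovK P K) (natY P K) with hH
  set g := fun t => (gradient (ℓ t) (surrogate P K cfg.h cfg.m t (z t))).ofLp with hg
  have hL := (hℓ 0).nonneg_const
  have hcK := A.cK_pos
  have hρ := A.ρK_pos
  have hρ1 : 0 < 1 - ρK := sub_pos.2 A.ρK_lt_one
  have hK := opNorm_nonneg K
  set D := cK / (1 - ρK) * (cfg.R * Rnat) with hD
  set l := fun t => lev (Λ (t + 1)) (H t) with hl
  have hRn : 0 ≤ cfg.R * Rnat := mul_nonneg hR A.Rnat_nonneg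
  have hex : ∀ s, nrm (algEx P K ℓ cfg z₁ s) ≤ cfg.R * Rnat := fun s => by
    rw [algEx_eq]
    exact nrm_embedY_mulVec_le A.Rnat_nonneg A.nrm_natY_le (N.mem s) s
  -- cost of the parameter drift and of the truncation
  have step : ∀ t, ℓ t (algIterate P K ℓ cfg z₁ t) - ℓ t (surrogate P K cfg.h cfg.m t (z t)) ≤
      L * r * (∑ i ∈ Finset.range (cfg.h + 1), (if i ≤ t then
        (1 + opNorm K) * (L * r / (2 * α)) * cK * ρK ^ i *
          ∑ k ∈ Finset.range i, (l (t - i) + l (t - i + k)) else 0) + D * ρK ^ cfg.h) := by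
    intro t
    have hn : ‖algIterate P K ℓ cfg z₁ t‖ ≤ r := by
      rw [algIterate_eq]
      exact ((norm_add_le _ _).trans (add_le_add (A.nat_le t)
        (nrm_markov_sum_le hcK hρ A.ρK_lt_one A.markov_le hRn fun i _ => hex _))).trans hr
    refine ((hℓ t).sub_le hα hr1 hn).trans (mul_le_mul_of_nonneg_left ?_ (by positivity))
    rw [algIterate_eq]
    refine (A.norm_driven_sub_surrogate_le hRn (z t) (ε := fun i => (1 + opNorm K) *
      (L * r / (2 * α) * ∑ k ∈ Finset.range i, (l (t - i) + l (t - i + k)))) hex ?_).trans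
        (le_of_eq ?_)
    · intro i hi _
      -- The input i rounds ago used the parameter of its own round, so the mismatch is a drift over
      -- i steps.
      have e : z t = z (t - i + i) := by rw [Nat.sub_add_cancel hi]
      rw [algEx_eq, ← mulVec_sub, ← nrm_neg, ← mulVec_neg, neg_sub, ← hz, e, ← WithLp.ofLp_sub]
      exact (nrm_embedY_le_featH P K cfg.h _ _).trans
        (mul_le_mul_of_nonneg_left (N.drift_le (t - i) i) (by positivity))
    · congr 1
      refine Finset.sum_congr rfl fun i _ => ?_
      split_ifs
      · ring
      · rfl
  -- regret of the surrogate losses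
  have ons : ∀ t, ℓ t (surrogate P K cfg.h cfg.m t (z t)) - ℓ t (surrogate P K cfg.h cfg.m t q) ≤
      g t ⬝ᵥ H t *ᵥ (z t - q).ofLp - α / 2 * nrm (H t *ᵥ (z t - q).ofLp) ^ 2 := by
    intro t
    have h := (hℓ t).add_inner_le (surrogate P K cfg.h cfg.m t (z t)) (surrogate P K cfg.h cfg.m t q)
    have e : surrogate P K cfg.h cfg.m t q - surrogate P K cfg.h cfg.m t (z t) =
        - WithLp.toLp 2 (H t *ᵥ (z t - q).ofLp) := by
      rw [surrogate, surrogate, add_sub_add_left_eq_sub, WithLp.ofLp_sub, mulVec_sub,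
        WithLp.toLp_sub, neg_sub]
    rw [e, inner_neg_right, inner_eq_dotProduct, norm_neg] at h
    change _ + -(g t ⬝ᵥ H t *ᵥ (z t - q).ofLp) + α / 2 * nrm (H t *ᵥ (z t - q).ofLp) ^ 2 ≤ _ at h
    linarith
  have hlev : ∑ t ∈ Finset.range T, l t ≤ cfg.m * (du * dy) * Real.log (1 + T) := by
    have h := N.sum_lev_le (fun t => (trace_featH_le hcK hρ A.ρK_lt_one A.markov_le A.Rnat_nonneg
      A.nrm_natY_le t).trans (mul_le_mul_of_nonneg_right hlam' (Nat.cast_nonneg _))) T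
    simpa using h
  have hdelay := sum_delayed_le (l := l)
    (w := fun i => (1 + opNorm K) * (L * r / (2 * α)) * cK * ρK ^ i)
    (fun t => N.lev_nonneg t) (fun i => by positivity) (cfg.h + 1) T
  have hw : ∑ i ∈ Finset.range (cfg.h + 1),
      (i : ℝ) * ((1 + opNorm K) * (L * r / (2 * α)) * cK * ρK ^ i) ≤
      (1 + opNorm K) * (L * r / (2 * α)) * cK * (1 / (1 - ρK) ^ 2) := by
    refine le_trans (le_of_eq ?_) (mul_le_mul_of_nonneg_left
      (sum_natCast_mul_pow_le hρ A.ρK_lt_one (cfg.h + 1)) (by positivity))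
    rw [Finset.mul_sum]
    exact Finset.sum_congr rfl fun i _ => by ring
  have hl0 : 0 ≤ ∑ t ∈ Finset.range T, l t := Finset.sum_nonneg fun t _ => N.lev_nonneg t
  have h1 := Finset.sum_le_sum fun t (_ : t ∈ Finset.range T) => step t
  have h2 := Finset.sum_le_sum fun t (_ : t ∈ Finset.range T) => ons t
  rw [← Finset.mul_sum, Finset.sum_add_distrib, Finset.sum_const, Finset.card_range,
    nsmul_eq_mul, Finset.sum_sub_distrib] at h1
  rw [Finset.sum_sub_distrib] at h2
  have h3 := N.regret_le hq T
  have h4 : α / 2 * cfg.lam * ‖z 0 - q‖ ^ 2 ≤ 2 * α * cfg.lam * (du * dy * cfg.R ^ 2) := by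
    have ha := drcSet_norm_sq_le (N.mem 0)
    have hb := drcSet_norm_sq_le hq
    have hc : ‖z 0 - q‖ ^ 2 ≤ 4 * (du * dy * cfg.R ^ 2) := by
      have := pow_le_pow_left₀ (norm_nonneg _) (norm_sub_le (z 0) q) 2
      nlinarith [sq_nonneg (‖z 0‖ - ‖q‖)]
    calc _ ≤ α / 2 * cfg.lam * (4 * (du * dy * cfg.R ^ 2)) :=
          mul_le_mul_of_nonneg_left hc (by positivity)
      _ = _ := by ring
  have h5 := mul_le_mul_of_nonneg_left (hdelay.trans (mul_le_mul_of_nonneg_right hw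
    (mul_nonneg zero_le_two hl0))) (show 0 ≤ L * r by positivity)
  have h6 : (L * r) ^ 2 / α * (1 / 2 + (1 + opNorm K) * cK / (1 - ρK) ^ 2) *
      ∑ t ∈ Finset.range T, l t ≤
      (L * r) ^ 2 / α * (1 / 2 + (1 + opNorm K) * cK / (1 - ρK) ^ 2) *
        (cfg.m * (du * dy) * Real.log (1 + T)) :=
    mul_le_mul_of_nonneg_left hlev (by positivity)
  have e5 : L * r * ((1 + opNorm K) * (L * r / (2 * α)) * cK * (1 / (1 - ρK) ^ 2) *
      (2 * ∑ t ∈ Finset.range T, l t)) + (L * r) ^ 2 / (2 * α) * ∑ t ∈ Finset.range T, l t =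
      (L * r) ^ 2 / α * (1 / 2 + (1 + opNorm K) * cK / (1 - ρK) ^ 2) *
        ∑ t ∈ Finset.range T, l t := by
    field_simp
    ring
  rw [mul_add] at h1
  linarith

/-- Every stabilizing controller is nearly matched by an admissible parameter. -/
lemma exists_surrogate_le (A : StableNominal P K Rnat cK ρK) (hℓ : ∀ t, LossRegular L α (ℓ t))
    (hα : 0 < α) {cs ρs : ℝ} (hcs : 1 ≤ cs)
    (hρs : 0 < ρs) (hρs1 : ρs < 1) {π : LDC du dy} (hπ : π ∈ stabClass P K cs ρs) (h m : ℕ)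
    {R : ℝ} (hR : R = (1 + opNorm K) * (cs / (1 - ρs))) {r : ℝ}
    (hr1 : 1 ≤ r) (hr : Rnat + cK / (1 - ρK) * (R * Rnat) ≤ r) :
    ∃ q ∈ drcSet m du dy R, ∀ t, ℓ t (surrogate P K h m t q) - ℓ t (ldcIterate P π t) ≤
      L * r * (cK / (1 - ρK) * (R * Rnat) * (ρs ^ m + ρK ^ h)) := by
  have hL := (hℓ 0).nonneg_const
  have hcK := A.cK_pos
  have hρ := A.ρK_pos
  have hρ1 : 0 < 1 - ρK := sub_pos.2 A.ρK_lt_one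
  have hs1 : 0 < 1 - ρs := sub_pos.2 hρs1
  have hK := opNorm_nonneg K
  have hR0 : 0 ≤ R := by rw [hR]; positivity
  have hRn : 0 ≤ R * Rnat := mul_nonneg hR0 A.Rnat_nonneg
  have hN := opNorm_responseMat_le P K hcs hρs hπ
  -- The comparator is the controller's response truncated to its first m lags; R is the full
  -- geometric sum of the bounds, so it is admissible.
  let q : Param m du dy := WithLp.toLp 2 fun j => responseMat P K π j.1 j.2.1 j.2.2
  have hqm : ∀ i : Fin m, q.mat i = responseMat P K π i := fun i => rfl
  have hq : q ∈ drcSet m du dy R := by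
    change ∑ i : Fin m, opNorm (q.mat i) ≤ R
    simp only [hqm]
    rw [Fin.sum_univ_eq_sum_range fun i => opNorm (responseMat P K π i)]
    calc _ ≤ ∑ i ∈ Finset.range m, (1 + opNorm K) * cs * ρs ^ i :=
          Finset.sum_le_sum fun i _ => hN i
      _ ≤ (1 + opNorm K) * cs * (1 / (1 - ρs)) := by
          rw [← Finset.mul_sum]
          exact mul_le_mul_of_nonneg_left (sum_pow_le hρs hρs1 m) (by positivity)
      _ = R := by rw [hR]; ring
  have hterm : ∀ i s, nrm (responseMat P K π i *ᵥ natY P K s) ≤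
      (1 + opNorm K) * cs * Rnat * ρs ^ i := fun i s =>
    (nrm_mulVec_le _ _).trans ((mul_le_mul (hN i) (A.nrm_natY_le s) (nrm_nonneg _)
      (by positivity)).trans (le_of_eq (by ring)))
  have hRn' := A.Rnat_nonneg
  have hex : ∀ s, nrm (ldcEx P K π s) ≤ R * Rnat := by
    intro s
    rw [ldcEx_eq]
    refine (nrm_sum_le _ _).trans ((Finset.sum_le_sum fun i _ => hterm i _).trans ?_)
    rw [← Finset.mul_sum]
    refine (mul_le_mul_of_nonneg_left (sum_pow_le hρs hρs1 _) (by positivity)).trans (le_of_eq ?_)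
    rw [hR]; ring
  have hdiff : ∀ s, nrm (ldcEx P K π s - embedY m du (natY P K) s *ᵥ q.ofLp) ≤
      R * Rnat * ρs ^ m := by
    intro s
    have e : embedY m du (natY P K) s *ᵥ q.ofLp = ∑ i ∈ Finset.range (s + 1),
        if i < m then responseMat P K π i *ᵥ natY P K (s - i) else 0 := by
      rw [embedY_mulVec, ← sum_range_ite_swap, ← Fin.sum_univ_eq_sum_range
        fun i => if i < s + 1 then responseMat P K π i *ᵥ natY P K (s - i) else 0]
      simp only [hqm, Nat.lt_succ_iff]
    rw [e, ldcEx_eq, ← Finset.sum_sub_distrib]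
    refine (nrm_sum_le _ _).trans ((Finset.sum_le_sum (g := fun i =>
      (1 + opNorm K) * cs * Rnat * (if i < m then 0 else ρs ^ i)) fun i _ => ?_).trans ?_)
    · split_ifs
      · rw [sub_self, nrm_zero, mul_zero]
      · rw [sub_zero]; exact hterm i _
    · rw [← Finset.mul_sum]
      refine (mul_le_mul_of_nonneg_left (sum_pow_tail_le hρs hρs1 _ _) (by positivity)).trans
        (le_of_eq ?_)
      rw [hR]; ring
  refine ⟨q, hq, fun t => ?_⟩
  refine ((hℓ t).sub_le hα hr1 ((A.norm_surrogate_le hR0 hq t).trans hr)).trans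
    (mul_le_mul_of_nonneg_left ?_ (by positivity))
  rw [norm_sub_rev, ldcIterate_eq P K]
  refine (A.norm_driven_sub_surrogate_le hRn q (ε := fun _ => R * Rnat * ρs ^ m) hex
    fun i _ _ => hdiff _).trans ?_
  rw [mul_add]
  refine add_le_add_left ?_ _
  calc _ ≤ ∑ i ∈ Finset.range (h + 1), cK * (R * Rnat * ρs ^ m) * ρK ^ i := by
        refine Finset.sum_le_sum fun i _ => ?_
        split_ifs
        · exact le_of_eq (by ring)
        · positivity
    _ ≤ cK * (R * Rnat * ρs ^ m) * (1 / (1 - ρK)) := by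
        rw [← Finset.mul_sum]
        exact mul_le_mul_of_nonneg_left (sum_pow_le hρ A.ρK_lt_one _) (by positivity)
    _ = _ := by ring

end StableNominal

end Regret

/-! ### Tuning of the parameters and collection of the error terms -/

section Assembly

/-- Bounding the infimum from below avoids near-minimizers and covers the empty class. -/
lemma controlRegret_le {dx du dy : ℕ} {P : Plant dx du dy} {ℓ : ℕ → Sig dy du → ℝ} {T : ℕ}
    {v : ℕ → Sig dy du} {cls : Set (LDC du dy)} {X : ℝ}
    (h : ∀ π ∈ cls, ∑ t ∈ Finset.range T, ℓ t (v t) -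
      ∑ t ∈ Finset.range T, ℓ t (ldcIterate P π t) ≤ X) :
    controlRegret P ℓ T v cls ≤ (X : EReal) := by
  have h1 : (((∑ t ∈ Finset.range T, ℓ t (v t)) - X : ℝ) : EReal) ≤
      ⨅ π ∈ cls, ((∑ t ∈ Finset.range T, ℓ t (ldcIterate P π t) : ℝ) : EReal) :=
    le_iInf₂ fun π hπ => EReal.coe_le_coe_iff.2 (by linarith [h π hπ])
  refine (EReal.sub_le_sub le_rfl h1).trans (le_of_eq ?_)
  rw [← EReal.coe_sub, sub_sub_cancel]

/-- From log ρ ≤ -(1 - ρ); this is what the choices of h and m are for. -/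
lemma pow_ceil_log_le {ρ : ℝ} (h0 : 0 < ρ) (h1 : ρ < 1) {T : ℕ} (hT : 0 < T) :
    ρ ^ ⌈Real.log T / (1 - ρ)⌉₊ ≤ 1 / T := by
  have hT' : (0 : ℝ) < T := Nat.cast_pos.2 hT
  have hle := Nat.le_ceil (Real.log T / (1 - ρ))
  set n := ⌈Real.log T / (1 - ρ)⌉₊
  rw [div_le_iff₀ (by linarith)] at hle
  rw [← Real.log_le_log_iff (by positivity) (by positivity), Real.log_pow, one_div, Real.log_inv]
  have h2 := mul_le_mul_of_nonneg_left (Real.log_le_sub_one_of_pos h0) (Nat.cast_nonneg (α := ℝ) n)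
  linarith

lemma one_le_log_one_add {T : ℕ} (hT : 2 ≤ T) : 1 ≤ Real.log (1 + T) := by
  have hT' : (2 : ℝ) ≤ T := by exact_mod_cast hT
  rw [Real.le_log_iff_exp_le (by linarith)]
  linarith [Real.exp_one_lt_three]

lemma ceil_log_le {ρ : ℝ} (h0 : 0 < ρ) (h1 : ρ < 1) {T : ℕ} (hT : 2 ≤ T) :
    (⌈Real.log T / (1 - ρ)⌉₊ : ℝ) ≤ 2 * Real.log (1 + T) * (1 / (1 - ρ)) := by
  have hρ : 0 < 1 - ρ := by linarith
  have hT' : (2 : ℝ) ≤ T := by exact_mod_cast hT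
  have hl := one_le_log_one_add hT
  have h2 : Real.log T ≤ Real.log (1 + T) := Real.log_le_log (by linarith) (by linarith)
  have h3 : 1 ≤ 1 / (1 - ρ) := by rw [le_div_iff₀ hρ]; linarith
  have h4 := (Nat.ceil_lt_add_one (div_nonneg (Real.log_nonneg (by linarith)) hρ.le :
    0 ≤ Real.log T / (1 - ρ))).le
  have h5 : Real.log T / (1 - ρ) ≤ Real.log (1 + T) * (1 / (1 - ρ)) := by
    rw [div_eq_mul_one_div]
    exact mul_le_mul_of_nonneg_right h2 (by linarith)
  nlinarith

lemma one_le_ceil_log {ρ : ℝ} (h1 : ρ < 1) {T : ℕ} (hT : 2 ≤ T) :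
    (1 : ℝ) ≤ ⌈Real.log T / (1 - ρ)⌉₊ := by
  have hT' : (2 : ℝ) ≤ T := by exact_mod_cast hT
  have : 0 < ⌈Real.log T / (1 - ρ)⌉₊ :=
    Nat.ceil_pos.2 (div_pos (Real.log_pos (by linarith)) (by linarith))
  exact_mod_cast this

variable {dx du dy : ℕ} {P : Plant dx du dy} {K : Matrix (Fin du) (Fin dy) ℝ}
  {ℓ : ℕ → Sig dy du → ℝ} {L α Rnat cK ρK : ℝ}

/-- The lag-0 block of G_K contains an identity, so it has an entry 1 as soon as there is an input.
-/
lemma StableNominal.one_le_cK (A : StableNominal P K Rnat cK ρK) (hdu : 0 < du) : 1 ≤ cK := by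
  have h := (abs_entry_le_opNorm (markovK P K 0) (Sum.inr ⟨0, hdu⟩) ⟨0, hdu⟩).trans (A.markov_le 0)
  simpa [markovK] using h

lemma LossRegular.le_const_of_pos {f : Sig dy du → ℝ} (h : LossRegular L α f) (hdu : 0 < du) :
    α ≤ L :=
  h.le_const (v := EuclideanSpace.single (Sum.inr ⟨0, hdu⟩) 1) (by simp)

/-- Without inputs or without outputs, every exogenous input vanishes. -/
lemma algIterate_eq_ldcIterate_of_degenerate (hd : du = 0 ∨ dy = 0) (cfg : Config)
    (z₁ : Param cfg.m du dy) (π : LDC du dy) (t : ℕ) :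
    algIterate P K ℓ cfg z₁ t = ldcIterate P π t := by
  have h1 : ∀ s, algEx P K ℓ cfg z₁ s = 0 := by
    intro s
    rcases hd with rfl | rfl
    · exact Subsingleton.elim _ _
    · rw [algEx_eq]
      funext a
      exact Finset.sum_of_isEmpty _
  have h2 : ∀ s, ldcEx P K π s = 0 := by
    intro s
    rcases hd with rfl | rfl
    · exact Subsingleton.elim _ _
    · rw [ldcEx_eq]
      funext a
      simp
  rw [algIterate_eq, ldcIterate_eq P K]
  simp only [h1, h2]

/-- Comparison of the collected error terms with the final rate, in terms of `a = 1 / (1 - ρ_K)`,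
`b = 1 / (1 - ρ⋆)` and `κ = 1 + ‖K‖`. -/
lemma error_terms_le {a b c s κ R n L α l h m : ℝ} (ha : 1 ≤ a) (hb : 1 ≤ b) (hc : 1 ≤ c)
    (hκ : 1 ≤ κ) (hn : 1 ≤ n) (hα : 0 < α) (hL : α ≤ L) (hl : 1 ≤ l)
    (hh : h ≤ 2 * l * a) (hm : m ≤ 2 * l * b) :
    6 * L * (c * a * (κ * (s * b) * R)) ^ 2 +
        12 * h * α * n * (c * a * (κ * (s * b) * R)) ^ 2 +
        (L * (2 * (c * a * (κ * (s * b) * R)))) ^ 2 / α * (1 / 2 + κ * c * a ^ 2) * (m * n * l) ≤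
      50 * (c ^ 3 * s ^ 2 * κ ^ 3 * (a ^ 5 * b ^ 3) * (n * R ^ 2) * (L ^ 2 / α) * l ^ 4) := by
  set D := c * a * (κ * (s * b) * R) with hDdef
  have hLα : L ≤ L ^ 2 / α := by rw [le_div_iff₀ hα]; nlinarith
  have hαα : α ≤ L ^ 2 / α := hL.trans hLα
  set Q := L ^ 2 / α with hQ
  have hQ0 : 0 < Q := hα.trans_le hαα
  have e0 : (L * (2 * D)) ^ 2 / α = 4 * Q * D ^ 2 := by rw [hQ]; ring
  have e1 : 50 * (c ^ 3 * s ^ 2 * κ ^ 3 * (a ^ 5 * b ^ 3) * (n * R ^ 2) * Q * l ^ 4) =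
      50 * (Q * D ^ 2 * n * (κ * c * a ^ 3 * b * l ^ 4)) := by rw [hDdef]; ring
  rw [e0, e1]
  have hW : ∀ x : ℝ, x ≤ κ * c * a ^ 3 * b * l ^ 4 →
      Q * D ^ 2 * n * x ≤ Q * D ^ 2 * n * (κ * c * a ^ 3 * b * l ^ 4) := fun x hx =>
    mul_le_mul_of_nonneg_left hx (by positivity)
  have t1 : 6 * L * D ^ 2 ≤ 6 * (Q * D ^ 2 * n * 1) := by
    have : L * D ^ 2 ≤ Q * D ^ 2 * n := by
      calc L * D ^ 2 ≤ Q * D ^ 2 := mul_le_mul_of_nonneg_right hLα (sq_nonneg D)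
        _ ≤ Q * D ^ 2 * n := le_mul_of_one_le_right (by positivity) hn
    linarith
  have t2 : 12 * h * α * n * D ^ 2 ≤ 24 * (Q * D ^ 2 * n * (l * a)) := by
    calc 12 * h * α * n * D ^ 2 = 12 * α * n * D ^ 2 * h := by ring
      _ ≤ 12 * α * n * D ^ 2 * (2 * l * a) := mul_le_mul_of_nonneg_left hh (by positivity)
      _ = α * (24 * D ^ 2 * n * (l * a)) := by ring
      _ ≤ Q * (24 * D ^ 2 * n * (l * a)) := mul_le_mul_of_nonneg_right hαα (by positivity)
      _ = _ := by ring
  have hkca : 1 ≤ κ * c * a ^ 2 :=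
    one_le_mul_of_one_le_of_one_le (one_le_mul_of_one_le_of_one_le hκ hc) (one_le_pow₀ ha)
  have t3 : 4 * Q * D ^ 2 * (1 / 2 + κ * c * a ^ 2) * (m * n * l) ≤
      12 * (Q * D ^ 2 * n * (κ * c * a ^ 2 * (l ^ 2 * b))) := by
    calc _ = 4 * Q * D ^ 2 * n * l * (1 / 2 + κ * c * a ^ 2) * m := by ring
      _ ≤ 4 * Q * D ^ 2 * n * l * (1 / 2 + κ * c * a ^ 2) * (2 * l * b) :=
          mul_le_mul_of_nonneg_left hm (by positivity)
      _ = 8 * Q * D ^ 2 * n * l ^ 2 * b * (1 / 2 + κ * c * a ^ 2) := by ring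
      _ ≤ 8 * Q * D ^ 2 * n * l ^ 2 * b * (3 / 2 * (κ * c * a ^ 2)) :=
          mul_le_mul_of_nonneg_left (by linarith) (by positivity)
      _ = _ := by ring
  have hl4 : 1 ≤ l ^ 4 := one_le_pow₀ hl
  have w3 : κ * c * a ^ 2 * (l ^ 2 * b) ≤ κ * c * a ^ 3 * b * l ^ 4 := by
    calc κ * c * a ^ 2 * (l ^ 2 * b) = κ * c * b * (a ^ 2 * l ^ 2) := by ring
      _ ≤ κ * c * b * (a ^ 3 * l ^ 4) := by
          gcongr <;> first | assumption | norm_num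
      _ = _ := by ring
  have w2 : l * a ≤ κ * c * a ^ 3 * b * l ^ 4 := by
    calc l * a = 1 * (l ^ 1 * a ^ 1) := by ring
      _ ≤ (κ * c * b) * (l ^ 4 * a ^ 3) := by
          refine mul_le_mul (one_le_mul_of_one_le_of_one_le
            (one_le_mul_of_one_le_of_one_le hκ hc) hb) ?_ (by positivity) (by positivity)
          gcongr <;> first | assumption | norm_num
      _ = _ := by ring
  have w1 : 1 ≤ κ * c * a ^ 3 * b * l ^ 4 := by
    refine le_trans ?_ w2
    exact one_le_mul_of_one_le_of_one_le hl ha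
  have := hW _ w1
  have := hW _ w2
  have := hW _ w3
  have h0 : 0 ≤ Q * D ^ 2 * n * (κ * c * a ^ 3 * b * l ^ 4) := by positivity
  -- The three coefficients 6, 24 and 12 add up to 42, within the constant 50.
  linarith

/-- Serves the horizon T = 1, where the bound contains log 2 < 1; the constant 50 compensates for
its fourth power. -/
lemma initial_loss_le {a b c s κ R n L α : ℝ} (ha : 1 ≤ a) (hb : 1 ≤ b) (hc : 1 ≤ c) (hs : 1 ≤ s)
    (hκ : 1 ≤ κ) (hn : 1 ≤ n) (hα : 0 < α) (hL : α ≤ L) :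
    L * R ^ 2 ≤ 50 * (c ^ 3 * s ^ 2 * κ ^ 3 * (a ^ 5 * b ^ 3) * (n * R ^ 2) * (L ^ 2 / α) *
      Real.log 2 ^ 4) := by
  have hLα : L ≤ L ^ 2 / α := by rw [le_div_iff₀ hα]; nlinarith
  have hl : 1 ≤ 50 * Real.log 2 ^ 4 := by
    have := pow_le_pow_left₀ (by norm_num) Real.log_two_gt_d9.le 4
    norm_num at this ⊢
    linarith
  have hF : 1 ≤ c ^ 3 * s ^ 2 * κ ^ 3 * (a ^ 5 * b ^ 3) * n := by
    refine one_le_mul_of_one_le_of_one_le (one_le_mul_of_one_le_of_one_le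
      (one_le_mul_of_one_le_of_one_le (one_le_mul_of_one_le_of_one_le ?_ ?_) ?_)
      (one_le_mul_of_one_le_of_one_le ?_ ?_)) hn <;> exact one_le_pow₀ (by assumption)
  have h0 : 0 ≤ L ^ 2 / α := by positivity
  calc L * R ^ 2 ≤ L ^ 2 / α * R ^ 2 := mul_le_mul_of_nonneg_right hLα (sq_nonneg R)
    _ ≤ L ^ 2 / α * R ^ 2 * ((c ^ 3 * s ^ 2 * κ ^ 3 * (a ^ 5 * b ^ 3) * n) *
          (50 * Real.log 2 ^ 4)) :=
        le_mul_of_one_le_right (by positivity) (one_le_mul_of_one_le_of_one_le hF hl)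
    _ = _ := by ring

/-- The regret bound against a single stabilizing controller. -/
lemma StableNominal.regret_le (A : StableNominal P K Rnat cK ρK) (hα : 0 < α)
    (hℓ : ∀ t, LossRegular L α (ℓ t)) {cs ρs : ℝ} (hcs : 1 ≤ cs) (hρs : 0 < ρs) (hρs1 : ρs < 1)
    (T : ℕ) {z₁ : Param (explicitConfig T K α Rnat cK ρK cs ρs).m du dy}
    (hz₁ : z₁ ∈ drcSet (explicitConfig T K α Rnat cK ρK cs ρs).m du dy
      (explicitConfig T K α Rnat cK ρK cs ρs).R)
    {π : LDC du dy} (hπ : π ∈ stabClass P K cs ρs) :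
    ∑ t ∈ Finset.range T,
        ℓ t (algIterate P K ℓ (explicitConfig T K α Rnat cK ρK cs ρs) z₁ t) -
      ∑ t ∈ Finset.range T, ℓ t (ldcIterate P π t) ≤
      50 * (cK ^ 3 * cs ^ 2 * (1 + opNorm K) ^ 3 / ((1 - ρK) ^ 5 * (1 - ρs) ^ 3) *
        ((du : ℝ) * (dy : ℝ) * Rnat ^ 2) * (L ^ 2 / α) * Real.log (1 + (T : ℝ)) ^ 4) := by
  have hρK := A.ρK_pos
  have hρ1 : 0 < 1 - ρK := sub_pos.2 A.ρK_lt_one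
  have hs1 : 0 < 1 - ρs := sub_pos.2 hρs1
  have hK := opNorm_nonneg K
  have hcK0 := A.cK_pos
  have hT0 : 0 ≤ Real.log (1 + (T : ℝ)) := Real.log_nonneg (by linarith [Nat.cast_nonneg (α := ℝ) T])
  -- Here the claimed bound is 0, so the trajectories must agree exactly.
  by_cases hd : du = 0 ∨ dy = 0
  · rw [Finset.sum_congr rfl fun t _ => by
      rw [algIterate_eq_ldcIterate_of_degenerate hd _ z₁ π t], sub_self]
    positivity
  push Not at hd
  have hdu : 0 < du := Nat.pos_of_ne_zero hd.1
  have hn : (1 : ℝ) ≤ du * dy := by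
    have : 1 ≤ du * dy := Nat.mul_pos hdu (Nat.pos_of_ne_zero hd.2)
    exact_mod_cast this
  have hL := (hℓ 0).le_const_of_pos hdu
  have hcK := A.one_le_cK hdu
  have hLp : 0 < L := hα.trans_le hL
  have hRn := A.one_le_Rnat
  have ha : 1 ≤ 1 / (1 - ρK) := by rw [le_div_iff₀ hρ1]; linarith
  have hb : 1 ≤ 1 / (1 - ρs) := by rw [le_div_iff₀ hs1]; linarith
  have hκ : 1 ≤ 1 + opNorm K := by linarith
  have eX : ∀ l : ℝ, cK ^ 3 * cs ^ 2 * (1 + opNorm K) ^ 3 / ((1 - ρK) ^ 5 * (1 - ρs) ^ 3) *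
        ((du : ℝ) * (dy : ℝ) * Rnat ^ 2) * (L ^ 2 / α) * l =
      cK ^ 3 * cs ^ 2 * (1 + opNorm K) ^ 3 * ((1 / (1 - ρK)) ^ 5 * (1 / (1 - ρs)) ^ 3) *
        ((du : ℝ) * (dy : ℝ) * Rnat ^ 2) * (L ^ 2 / α) * l := by
    intro l; field_simp
  rw [eX]
  -- For T ≤ 1, log T = 0 gives h = m = 0 and λ = 0, so the Newton analysis does not apply. At T = 1
  -- the algorithm just plays u = Ky.
  rcases Nat.lt_or_ge T 2 with hT | hT
  · obtain rfl | rfl : T = 0 ∨ T = 1 := by omega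
    · simp
    · have hm : (explicitConfig 1 K α Rnat cK ρK cs ρs).m = 0 := by simp [explicitConfig]
      have hv : algIterate P K ℓ (explicitConfig 1 K α Rnat cK ρK cs ρs) z₁ 0 =
          natIterate P K 0 := by
        have hu : algEx P K ℓ (explicitConfig 1 K α Rnat cK ρK cs ρs) z₁ 0 = 0 := by
          rw [algEx_eq, embedY_mulVec]
          refine Finset.sum_eq_zero fun i _ => ?_
          have := i.2
          omega
        rw [algIterate_eq]
        simp [hu]
      have h1 : ℓ 0 (natIterate P K 0) ≤ L * Rnat ^ 2 :=
        ((hℓ 0).le _).trans (mul_le_mul_of_nonneg_left (max_le (one_le_pow₀ hRn)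
          (pow_le_pow_left₀ (norm_nonneg _) (A.nat_le 0) 2)) hLp.le)
      have h2 := (hℓ 0).nonneg (ldcIterate P π 0)
      have h3 := initial_loss_le (R := Rnat) ha hb hcK hcs hκ hn hα hL
      simp only [Finset.sum_range_one, hv, Nat.cast_one]
      norm_num at h3 ⊢
      linarith
  · have hl := one_le_log_one_add hT
    have hTp : (0 : ℝ) < T := by positivity
    set cfg := explicitConfig T K α Rnat cK ρK cs ρs with hcfg
    have hR : cfg.R = (1 + opNorm K) * (cs / (1 - ρs)) := rfl
    have hh : (cfg.h : ℝ) ≤ 2 * Real.log (1 + T) * (1 / (1 - ρK)) := ceil_log_le hρK A.ρK_lt_one hT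
    have hm : (cfg.m : ℝ) ≤ 2 * Real.log (1 + T) * (1 / (1 - ρs)) := ceil_log_le hρs hρs1 hT
    have hh1 : (1 : ℝ) ≤ cfg.h := one_le_ceil_log A.ρK_lt_one hT
    have hlam : cfg.lam = 6 * (cfg.h : ℝ) * Rnat ^ 2 * (cK / (1 - ρK)) ^ 2 := rfl
    have hR1 : 1 ≤ cfg.R := by
      rw [hR, div_eq_mul_one_div]
      exact one_le_mul_of_one_le_of_one_le hκ (one_le_mul_of_one_le_of_one_le hcs hb)
    have hca : 1 ≤ cK / (1 - ρK) := by
      rw [div_eq_mul_one_div]; exact one_le_mul_of_one_le_of_one_le hcK ha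
    set D := cK / (1 - ρK) * (cfg.R * Rnat) with hD
    have hRD : Rnat ≤ D := by
      calc Rnat = 1 * (1 * Rnat) := by ring
        _ ≤ D := by rw [hD]; gcongr
    have hD1 : 1 ≤ D := hRn.trans hRD
    have hlam0 : (cK / (1 - ρK) * Rnat) ^ 2 ≤ cfg.lam := by
      rw [hlam]
      have : 0 ≤ Rnat ^ 2 * (cK / (1 - ρK)) ^ 2 := by positivity
      nlinarith
    have hlampos : 0 < cfg.lam := lt_of_lt_of_le (by positivity) hlam0
    have hr : Rnat + cK / (1 - ρK) * (cfg.R * Rnat) ≤ 2 * D := by linarith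
    have hpK : ρK ^ cfg.h ≤ 1 / T := pow_ceil_log_le hρK A.ρK_lt_one (by omega)
    have hps : ρs ^ cfg.m ≤ 1 / T := pow_ceil_log_le hρs hρs1 (by omega)
    obtain ⟨q, hq, hqle⟩ := A.exists_surrogate_le hℓ hα hcs hρs hρs1 hπ cfg.h cfg.m hR
      (r := 2 * D) (by linarith) hr
    have h1 := A.sum_loss_alg_sub_le hℓ hα (zero_le_one.trans hR1) rfl hlampos hlam0 hz₁
      (r := 2 * D) (by linarith) hr hq T
    have h2 := Finset.sum_le_sum fun t (_ : t ∈ Finset.range T) => hqle t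
    rw [Finset.sum_sub_distrib, Finset.sum_const, Finset.card_range, nsmul_eq_mul, ← hD] at h2
    have hTT : (T : ℝ) * (1 / T) = 1 := by field_simp
    have h3 : L * (2 * D) * (T * (D * ρK ^ cfg.h)) ≤ 2 * L * D ^ 2 := by
      calc _ ≤ L * (2 * D) * (T * (D * (1 / T))) := by gcongr
        _ = 2 * L * D ^ 2 * (T * (1 / T)) := by ring
        _ = _ := by rw [hTT, mul_one]
    have h4 : T * (L * (2 * D) * (D * (ρs ^ cfg.m + ρK ^ cfg.h))) ≤ 4 * L * D ^ 2 := by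
      calc _ ≤ T * (L * (2 * D) * (D * (1 / T + 1 / T))) := by gcongr
        _ = 4 * L * D ^ 2 * (T * (1 / T)) := by ring
        _ = _ := by rw [hTT, mul_one]
    have h5 : 2 * α * cfg.lam * (du * dy * cfg.R ^ 2) = 12 * cfg.h * α * (du * dy) * D ^ 2 := by
      rw [hlam, hD]; ring
    have eD : D = cK * (1 / (1 - ρK)) * ((1 + opNorm K) * (cs * (1 / (1 - ρs))) * Rnat) := by
      rw [hD, hR]; ring
    have h6 := error_terms_le (s := cs) (R := Rnat) (h := cfg.h) (m := cfg.m) ha hb hcK hκ hn hα hL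
      hl hh hm
    rw [← eD] at h6
    have e7 : (1 + opNorm K) * cK / (1 - ρK) ^ 2 = (1 + opNorm K) * cK * (1 / (1 - ρK)) ^ 2 := by
      rw [_root_.one_div_pow, ← div_eq_mul_one_div]
    rw [e7, h5] at h1
    linarith

end Assembly

end DrcOns

theorem mainTheorem3 :
    ∃ Cst : ℝ, 0 < Cst ∧
      ∀ (dx du dy T : ℕ) (P : DrcOns.Plant dx du dy) (K : Matrix (Fin du) (Fin dy) ℝ)
        (ℓ : ℕ → DrcOns.Sig dy du → ℝ) (L α Rnat cK ρK cs ρs : ℝ),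
        0 < α →
        (∀ t, DrcOns.LossRegular L α (ℓ t)) →
        1 ≤ Rnat →
        (∀ t, ‖DrcOns.natIterate P K t‖ ≤ Rnat) →
        0 < cK → 0 < ρK → ρK < 1 →
        (∀ n : ℕ, DrcOns.opNorm (DrcOns.markovK P K n) ≤ cK * ρK ^ n) →
        1 ≤ cs → 0 < ρs → ρs < 1 →
        ∀ z₁ ∈ DrcOns.drcSet (DrcOns.explicitConfig T K α Rnat cK ρK cs ρs).m du dy
            (DrcOns.explicitConfig T K α Rnat cK ρK cs ρs).R,
          DrcOns.controlRegret P ℓ T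
              (DrcOns.algIterate P K ℓ (DrcOns.explicitConfig T K α Rnat cK ρK cs ρs) z₁)
              (DrcOns.stabClass P K cs ρs) ≤
            ((Cst *
              (cK ^ 3 * cs ^ 2 * (1 + DrcOns.opNorm K) ^ 3 / ((1 - ρK) ^ 5 * (1 - ρs) ^ 3) *
                ((du : ℝ) * (dy : ℝ) * Rnat ^ 2) * (L ^ 2 / α) *
                Real.log (1 + (T : ℝ)) ^ 4) : ℝ) : EReal) := by
  refine ⟨50, by norm_num, ?_⟩
  intro dx du dy T P K ℓ L α Rnat cK ρK cs ρs hα hℓ hRn hnat hcK hρK hρK1 hG hcs hρs hρs1 z₁ hz₁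
  exact DrcOns.controlRegret_le fun π hπ =>
    DrcOns.StableNominal.regret_le ⟨hRn, hnat, hcK, hρK, hρK1, hG⟩ hα hℓ hcs hρs hρs1 T hz₁ hπ
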